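/- Let $\mathcal F$ denote the class of completely multiplicative functions $f:\mathbb{Z}_{\ge 1}\to\mathbb{C}$ (that is, $f(1)=1$ and $f(mn)=f(m)f(n)$ for all $m,n\ge 1$) with $|f(n)|\le 1$ for all $n\ge 1$. For $f,g\in\mathcal F$ and real $y$ put $$\mathbb{D}(f,g;y):=\Bigg(\sum_{\substack{p\le y\\ p\text{ prime}}}\frac{1-\operatorname{Re}\big(f(p)\overline{g(p)}\big)}{p}\Bigg)^{1/2},\qquad \mathcal{M}(f;y,T):=\min_{t\in\mathbb{R},\ |t|\le T}\mathbb{D}(f,n^{it};y)^2,$$ where $n^{it}$ denotes the function $n\mapsto n^{it}$, and let $\mathcal{S}(y)$ be the set of $y$-friable integers, i.e. of positive integers all of whose prime factors are at most $y$. There is an absolute constant $C>0$ such that for every $f\in\mathcal F$, all real numbers $x,y\ge 2$ and every real number $0<T\le 1$, $$\Bigg|\sum_{\substack{n\le x\\ n\in\mathcal{S}(y)}}\frac{f(n)}{n}\Bigg|\le C\left((\log y)\exp\big(-\mathcal{M}(f;y,T)\big)+\frac1T\right).$$ -/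

import Mathlib

open Finset

/-- The class `𝓕` of completely multiplicative functions `f` on the positive integers with
`|f n| ≤ 1` for all `n ≥ 1`. The value `f 0` is unconstrained and never used. -/
structure IsUnitBoundedCM (f : ℕ → ℂ) : Prop where
  map_one : f 1 = 1
  map_mul : ∀ m n : ℕ, 1 ≤ m → 1 ≤ n → f (m * n) = f m * f n
  norm_le_one : ∀ n : ℕ, 1 ≤ n → ‖f n‖ ≤ 1

/-- The distance `𝔻(f, g; y) = (∑_{p ≤ y} (1 - Re (f(p) conj(g(p)))) / p)^{1/2}`,
the sum being over primes `p ≤ y`. -/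
noncomputable def pretentiousDist (f g : ℕ → ℂ) (y : ℝ) : ℝ :=
  Real.sqrt (∑ p ∈ Icc 1 ⌊y⌋₊ with p.Prime,
    (1 - (f p * (starRingEnd ℂ) (g p)).re) / (p : ℝ))

/-- The Archimedean character `n ↦ n^{it}`. -/
noncomputable def archChar (t : ℝ) : ℕ → ℂ := fun n => (n : ℂ) ^ (Complex.I * (t : ℂ))

/-- `𝓜(f; y, T) = min_{|t| ≤ T} 𝔻(f, n^{it}; y)²`. For `T ≥ 0` the minimum is attained, see
`isLeast_minDistSq`. -/
noncomputable def minDistSq (f : ℕ → ℂ) (y T : ℝ) : ℝ :=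
  sInf ((fun t : ℝ => pretentiousDist f (archChar t) y ^ 2) '' {t : ℝ | |t| ≤ T})

/-- The set `𝓢(y)` of `y`-friable integers: positive integers all of whose prime factors are
at most `y`. -/
def friable (y : ℝ) : Set ℕ := {n : ℕ | 1 ≤ n ∧ ∀ p : ℕ, p.Prime → p ∣ n → (p : ℝ) ≤ y}

noncomputable instance friable.decidablePred (y : ℝ) : DecidablePred (· ∈ friable y) :=
  Classical.decPred _

/-- The infimum in the definition of `𝓜(f; y, T)` is a minimum. -/
theorem isLeast_minDistSq (f : ℕ → ℂ) (y T : ℝ) (hT : 0 ≤ T) :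
    IsLeast ((fun t : ℝ => pretentiousDist f (archChar t) y ^ 2) '' {t : ℝ | |t| ≤ T})
      (minDistSq f y T) := by
  have hset : {t : ℝ | |t| ≤ T} = Set.Icc (-T) T := by
    ext t; simp [abs_le]
  have hcont : Continuous (fun t : ℝ => pretentiousDist f (archChar t) y ^ 2) := by
    unfold pretentiousDist archChar
    refine Continuous.pow (Real.continuous_sqrt.comp ?_) 2
    refine continuous_finsetSum _ fun p hp => ?_
    have hp0 : (p : ℂ) ≠ 0 := by
      have := (Finset.mem_filter.mp hp).2.ne_zero
      exact_mod_cast this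
    have h1 : Continuous (fun t : ℝ => (p : ℂ) ^ (Complex.I * (t : ℂ))) :=
      Continuous.const_cpow (by fun_prop) (Or.inl hp0)
    exact (continuous_const.sub (Complex.continuous_re.comp
      (continuous_const.mul (Complex.continuous_conj.comp h1)))).div_const _
  have hc : IsCompact ((fun t : ℝ => pretentiousDist f (archChar t) y ^ 2) ''
      {t : ℝ | |t| ≤ T}) := by
    rw [hset]; exact isCompact_Icc.image hcont
  exact hc.isLeast_sInf (Set.Nonempty.image _ ⟨0, by simpa using hT⟩)

/-- The square of the distance is the defining sum (no truncation by the square root). -/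
theorem pretentiousDist_sq {f g : ℕ → ℂ} (hf : IsUnitBoundedCM f)
    (hg : IsUnitBoundedCM g) (y : ℝ) :
    pretentiousDist f g y ^ 2 = ∑ p ∈ Icc 1 ⌊y⌋₊ with p.Prime,
      (1 - (f p * (starRingEnd ℂ) (g p)).re) / (p : ℝ) := by
  refine Real.sq_sqrt (Finset.sum_nonneg fun p hp => div_nonneg ?_ (Nat.cast_nonneg p))
  have h1 := (Finset.mem_Icc.mp (Finset.mem_filter.mp hp).1).1
  have h2 : ‖f p * (starRingEnd ℂ) (g p)‖ ≤ 1 := by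
    rw [norm_mul, RCLike.norm_conj]
    exact mul_le_one₀ (hf.norm_le_one p h1) (norm_nonneg _) (hg.norm_le_one p h1)
  linarith [Complex.re_le_norm (f p * (starRingEnd ℂ) (g p))]

/-- `n ↦ n^{it}` belongs to `𝓕`. -/
theorem isUnitBoundedCM_archChar (t : ℝ) : IsUnitBoundedCM (archChar t) where
  map_one := by simp [archChar]
  map_mul m n _ _ := by
    simp only [archChar, Nat.cast_mul]
    exact Complex.natCast_mul_natCast_cpow m n _
  norm_le_one n hn := by
    simp [archChar, Complex.norm_natCast_cpow_of_pos hn]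

/-! Put g = f on `friable y` and 0 elsewhere; g is completely multiplicative and its Dirichlet
series on Re s = 1 converges absolutely to a finite Euler product F(v) = ∑ g(n) n^(-1+2πiv). Taking
logarithms and using Mertens' upper bound, |F(v)| ≪ (log y) exp(-𝔻(f, n^(-2πiv); y)²), so for |2πv|
≤ T it is at most a constant times A = (log y) exp(-𝓜(f; y, T))
(`exists_norm_friableEulerProduct_le`).

The rest is Halász's method for S(u) = ∑_{n ≤ e^u} g(n)/n with L = log x. On [0, L], S(u) is the sum
of g(n)/n against the indicator of [0, L] at u - log n. Replacing that indicator by the Fourier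
transform of some W supported in |2πv| ≤ T (`exists_bandlimited_approx`) costs O(1/T) and leaves the
Fourier transform of W F. By Plancherel its squared L² norm is O(A² L), so S has L¹ mean O(A + 1/T)
on [0, L] (`exists_integral_norm_logSum_exp_le`).

To pass from the mean to the endpoint, split log x = log(x/n) + log n. The first part is the
integral of S; the second, by log = Λ * 1, is ∑ Λ(d) g(d)/d · S(log(x/d)), which Chebyshev's bound
and the slow variation of S control by the L¹ mean (`exists_norm_logSum_le`). -/

/-! ### Band-limited approximation to an interval -/

open MeasureTheory Real in
/-- The Fourier transform of the indicator function of `[0, L]`. -/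
noncomputable def intervalKernel (L v : ℝ) : ℂ :=
  ∫ r in (0 : ℝ)..L, Complex.exp ((2 * π * (r * v) : ℝ) * Complex.I)

/-- The difference quotient of exp at 0 is entire, so this form gives smoothness across v = 0. -/
theorem intervalKernel_eq_dslope (L v : ℝ) :
    intervalKernel L v =
      L * dslope Complex.exp 0 ((2 * Real.pi * L * v : ℝ) * Complex.I) := by
  rcases eq_or_ne v 0 with rfl | hv
  · simp [intervalKernel]
  rcases eq_or_ne L 0 with rfl | hL
  · simp [intervalKernel]
  have hc : ((2 * Real.pi * v : ℝ) * Complex.I) ≠ 0 := by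
    simp [hv, Real.pi_ne_zero]
  have hz : ((2 * Real.pi * L * v : ℝ) * Complex.I) ≠ 0 := by
    simp [hv, hL, Real.pi_ne_zero]
  rw [dslope_of_ne _ hz, slope_def_field, intervalKernel]
  have : ∀ r : ℝ, Complex.exp ((2 * Real.pi * (r * v) : ℝ) * Complex.I) =
      Complex.exp (((2 * Real.pi * v : ℝ) * Complex.I) * r) := by
    intro r; congr 1; push_cast; ring
  simp_rw [this]
  rw [integral_exp_mul_complex hc]
  have hL' : (L : ℂ) ≠ 0 := by exact_mod_cast hL
  have hv' : (v : ℂ) ≠ 0 := by exact_mod_cast hv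
  have hp' : (Real.pi : ℂ) ≠ 0 := by exact_mod_cast Real.pi_ne_zero
  have e : ((2 * Real.pi * v : ℝ) * Complex.I) * L = ((2 * Real.pi * L * v : ℝ) * Complex.I) := by
    push_cast; ring
  rw [e]
  simp only [Complex.ofReal_zero, mul_zero, Complex.exp_zero, sub_zero]
  push_cast
  field_simp

theorem contDiff_intervalKernel (L : ℝ) {n : WithTop ℕ∞} : ContDiff ℝ n (intervalKernel L) := by
  have h1 : Differentiable ℂ (dslope Complex.exp 0) := by
    rw [← differentiableOn_univ, Complex.differentiableOn_dslope Filter.univ_mem]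
    exact Complex.differentiable_exp.differentiableOn
  have h2 : ContDiff ℝ n (dslope Complex.exp 0) := h1.contDiff.restrict_scalars ℝ
  have h3 : ContDiff ℝ n (fun v : ℝ => ((2 * Real.pi * L * v : ℝ) * Complex.I)) :=
    (Complex.ofRealCLM.contDiff.comp (contDiff_const.mul contDiff_id)).mul contDiff_const
  have : intervalKernel L =
      fun v => L * dslope Complex.exp 0 ((2 * Real.pi * L * v : ℝ) * Complex.I) :=
    funext (intervalKernel_eq_dslope L)
  rw [this]
  exact contDiff_const.mul (h2.comp h3)

theorem norm_intervalKernel_le {L : ℝ} (hL : 0 ≤ L) (v : ℝ) : ‖intervalKernel L v‖ ≤ L := by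
  have := intervalIntegral.norm_integral_le_of_norm_le_const (a := 0) (b := L) (C := 1)
    (f := fun r : ℝ => Complex.exp ((2 * Real.pi * (r * v) : ℝ) * Complex.I))
    (fun r _ => (Complex.norm_exp_ofReal_mul_I _).le)
  simpa [intervalKernel, abs_of_nonneg hL] using this

theorem norm_intervalKernel_mul_le (L v : ℝ) : ‖intervalKernel L v‖ * |v| ≤ 1 := by
  rcases eq_or_ne v 0 with rfl | hv
  · simp
  have hc : ((2 * Real.pi * v : ℝ) * Complex.I) ≠ 0 := by
    simp [hv, Real.pi_ne_zero]
  have : ∀ r : ℝ, Complex.exp ((2 * Real.pi * (r * v) : ℝ) * Complex.I) =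
      Complex.exp (((2 * Real.pi * v : ℝ) * Complex.I) * r) := by
    intro r; congr 1; push_cast; ring
  rw [intervalKernel]
  simp_rw [this]
  rw [integral_exp_mul_complex hc, norm_div, norm_mul, Complex.norm_I, mul_one, Complex.norm_real,
    Real.norm_eq_abs, abs_mul, abs_of_pos Real.two_pi_pos, div_mul_eq_mul_div,
    mul_div_mul_right _ _ (abs_ne_zero.mpr hv), div_le_one Real.two_pi_pos]
  have e : ∀ r : ℝ, ‖Complex.exp (((2 * Real.pi * v : ℝ) * Complex.I) * r)‖ = 1 := by
    intro r; rw [← this]; exact Complex.norm_exp_ofReal_mul_I _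
  calc _ ≤ 1 + 1 := (norm_sub_le _ _).trans (by rw [e, e])
    _ ≤ _ := by linarith [Real.pi_gt_three]

/-- Merges the bounds L and 1/|v| into one majorant of integral O(L), as needed for Plancherel. -/
theorem norm_intervalKernel_sq_le {L : ℝ} (hL : 0 ≤ L) (v : ℝ) :
    ‖intervalKernel L v‖ ^ 2 ≤ 2 * L ^ 2 * (1 + (L * v) ^ 2)⁻¹ := by
  rw [← div_eq_mul_inv, le_div_iff₀ (by positivity)]
  have h1 := norm_intervalKernel_le hL v
  have h2 := norm_intervalKernel_mul_le L v
  have h3 : ‖intervalKernel L v‖ ^ 2 ≤ L ^ 2 := by gcongr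
  have h4 : (‖intervalKernel L v‖ * |v|) ^ 2 ≤ 1 := pow_le_one₀ (by positivity) h2
  rw [mul_pow, sq_abs] at h4
  nlinarith [sq_nonneg L]

theorem integral_norm_intervalKernel_sq_majorant {L : ℝ} (hL : 0 < L) :
    MeasureTheory.Integrable (fun v : ℝ => 2 * L ^ 2 * (1 + (L * v) ^ 2)⁻¹) ∧
    ∫ v : ℝ, 2 * L ^ 2 * (1 + (L * v) ^ 2)⁻¹ = 2 * Real.pi * L := by
  refine ⟨((integrable_inv_one_add_sq.comp_mul_left' hL.ne')).const_mul _, ?_⟩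
  rw [MeasureTheory.integral_const_mul,
    MeasureTheory.Measure.integral_comp_mul_left (fun v : ℝ => (1 + v ^ 2)⁻¹) L,
    integral_univ_inv_one_add_sq, abs_of_pos (inv_pos.mpr hL), smul_eq_mul]
  field_simp

open FourierTransform SchwartzMap in
/-- A Schwartz function of integral one whose Fourier transform is compactly supported. -/
theorem exists_schwartz_bandlimited :
    ∃ w : 𝓢(ℝ, ℂ), (∀ v, ‖w v‖ ≤ 1) ∧ (∀ v, w v ≠ 0 → |2 * Real.pi * v| ≤ 1) ∧
      HasCompactSupport w ∧ ∫ r, (𝓕 w) r = 1 := by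
  -- Outer radius 1/7 suffices because 2π/7 < 1; the value 1 at 0 gives integral one by Fourier
  -- inversion.
  let b : ContDiffBump (0 : ℝ) := ⟨1 / 14, 1 / 7, by norm_num, by norm_num⟩
  have hcs : HasCompactSupport (fun v : ℝ => (b v : ℂ)) :=
    b.hasCompactSupport.comp_left (g := fun x : ℝ => (x : ℂ)) (by simp)
  have hcd : ContDiff ℝ (⊤ : ℕ∞) (fun v : ℝ => (b v : ℂ)) :=
    Complex.ofRealCLM.contDiff.comp b.contDiff
  refine ⟨hcs.toSchwartzMap hcd, fun v => ?_, fun v hv => ?_, hcs, ?_⟩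
  · change ‖((b v : ℝ) : ℂ)‖ ≤ 1
    rw [Complex.norm_real, Real.norm_eq_abs, abs_of_nonneg b.nonneg]
    exact b.le_one
  · have : b v ≠ 0 := by
      have hv' : ((b v : ℝ) : ℂ) ≠ 0 := hv
      exact_mod_cast hv'
    have h2 : v ∈ Function.support b := this
    rw [b.support_eq, Metric.mem_ball, dist_zero_right, Real.norm_eq_abs] at h2
    have h3 : |v| < 1 / 7 := h2
    rw [abs_mul, abs_of_pos Real.two_pi_pos]
    have := Real.pi_lt_d2
    nlinarith [abs_nonneg v, Real.pi_pos]
  · set w := hcs.toSchwartzMap hcd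
    have h1 : (𝓕⁻ (𝓕 w)) 0 = w 0 := by rw [FourierPair.fourierInv_fourier_eq]
    rw [SchwartzMap.fourierInv_coe, Real.fourierInv_eq] at h1
    simp only [inner_zero_right, AddChar.map_zero_eq_one, one_smul] at h1
    rw [h1]
    have : b 0 = 1 := b.one_of_mem_closedBall (by simp [b.rIn_pos.le])
    change ((b 0 : ℝ) : ℂ) = 1
    rw [this]; simp

-- Products become convolutions: the right side is the indicator of (0, L] smoothed at scale 1/T by
-- the transform of `w`.
open FourierTransform SchwartzMap MeasureTheory in
theorem fourier_comp_mul_intervalKernel (w : 𝓢(ℝ, ℂ)) {T : ℝ} (hT : 0 < T) {L : ℝ} (hL : 0 ≤ L)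
    (z : ℝ) :
    𝓕 (fun v : ℝ => w (T⁻¹ * v) * intervalKernel L v) z =
      ∫ r, (Set.Ioc 0 L).indicator (fun r => (T : ℂ) * (𝓕 w) (T * (z - r))) r := by
  have key : ∀ r : ℝ, (T : ℂ) * (𝓕 w) (T * (z - r)) =
      ∫ v : ℝ, Complex.exp ((2 * Real.pi * (r * v) : ℝ) * Complex.I) *
        (Complex.exp ((-2 * Real.pi * (z * v) : ℝ) * Complex.I) * w (T⁻¹ * v)) := by
    intro r
    rw [SchwartzMap.fourier_coe, Real.fourier_eq']
    have := Measure.integral_comp_mul_left (fun v : ℝ =>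
      Complex.exp ((-2 * Real.pi * inner ℝ v (T * (z - r)) : ℝ) * Complex.I) • w v) T⁻¹
    rw [inv_inv, abs_of_pos hT, Complex.real_smul] at this
    rw [← this]
    refine integral_congr_ae (.of_forall fun v => ?_)
    simp only [smul_eq_mul]
    rw [← mul_assoc, ← Complex.exp_add]
    congr 2
    simp only [RCLike.inner_apply, conj_trivial]
    push_cast
    have : (T : ℂ) ≠ 0 := by exact_mod_cast hT.ne'
    field_simp
    ring
  have hwi : Integrable (fun v : ℝ => w (T⁻¹ * v)) :=
    (w.integrable (μ := volume)).comp_mul_left' (inv_ne_zero hT.ne')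
  rw [integral_indicator measurableSet_Ioc, Real.fourier_eq']
  simp_rw [key]
  rw [integral_integral_swap]
  · refine integral_congr_ae (.of_forall fun v => ?_)
    simp only [smul_eq_mul]
    rw [integral_mul_const, intervalKernel, intervalIntegral.integral_of_le hL]
    simp only [RCLike.inner_apply, conj_trivial]
    ring
  · have h1 : Integrable (fun p : ℝ × ℝ => (1 : ℂ) * w (T⁻¹ * p.2))
        ((volume.restrict (Set.Ioc 0 L)).prod volume) :=
      Integrable.mul_prod (integrable_const _) hwi
    refine h1.mono ?_ (.of_forall fun p => ?_)
    · have hc : Continuous (fun p : ℝ × ℝ =>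
        Complex.exp ((2 * Real.pi * (p.1 * p.2) : ℝ) * Complex.I) *
        (Complex.exp ((-2 * Real.pi * (z * p.2) : ℝ) * Complex.I) * w (T⁻¹ * p.2))) := by
        have := w.continuous
        fun_prop
      exact hc.aestronglyMeasurable
    · simp only [Function.uncurry]
      rw [norm_mul, norm_mul, Complex.norm_exp_ofReal_mul_I, Complex.norm_exp_ofReal_mul_I]
      simp

/-- If the two indicators differ, an endpoint 0 or L separates z from r, so z is within |z - r| of
that endpoint. -/
theorem norm_indicator_sub_le {T L z r : ℝ} :
    ‖(if z ∈ Set.Icc 0 L then (1 : ℂ) else 0) - (if r ∈ Set.Ioc 0 L then (1 : ℂ) else 0)‖ ≤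
      (1 + (T * (z - r)) ^ 2) * ((1 + (T * z) ^ 2)⁻¹ + (1 + (T * (z - L)) ^ 2)⁻¹) := by
  have gen : ∀ c : ℝ, |c| ≤ |z - r| →
      1 ≤ (1 + (T * (z - r)) ^ 2) * (1 + (T * c) ^ 2)⁻¹ := by
    intro c hc
    rw [← div_eq_mul_inv, le_div_iff₀ (by positivity), one_mul]
    have : c ^ 2 ≤ (z - r) ^ 2 := sq_le_sq.mpr hc
    rw [mul_pow, mul_pow]
    gcongr
  have pos : ∀ c : ℝ, 0 ≤ (1 + (T * (z - r)) ^ 2) * (1 + (T * c) ^ 2)⁻¹ := fun c => by positivity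
  rw [mul_add]
  by_cases h1 : z ∈ Set.Icc 0 L <;> by_cases h2 : r ∈ Set.Ioc 0 L <;>
    simp only [h1, h2, if_true, if_false, sub_self, sub_zero, zero_sub, norm_neg, norm_zero,
      norm_one]
  · linarith [pos z, pos (z - L)]
  · simp only [Set.mem_Icc, Set.mem_Ioc, not_and_or, not_le] at h1 h2
    rcases h2 with h2 | h2
    · have := gen z (by rw [abs_of_nonneg h1.1, abs_of_nonneg] <;> linarith)
      linarith [pos (z - L)]
    · have := gen (z - L) (by rw [abs_of_nonpos, abs_of_nonpos] <;> linarith)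
      linarith [pos z]
  · simp only [Set.mem_Icc, Set.mem_Ioc, not_and_or, not_le] at h1 h2
    rcases h1 with h1 | h1
    · have := gen z (by rw [abs_of_nonpos, abs_of_nonpos] <;> linarith)
      linarith [pos (z - L)]
    · have := gen (z - L) (by rw [abs_of_nonneg, abs_of_nonneg] <;> linarith)
      linarith [pos z]
  · linarith [pos z, pos (z - L)]

open FourierTransform SchwartzMap MeasureTheory in
/-- A band-limited approximation to the indicator function of `[0, L]`. -/
theorem exists_bandlimited_approx :
    ∃ C : ℝ, 0 < C ∧ ∀ T L : ℝ, 0 < T → 0 ≤ L → ∃ W : ℝ → ℂ, HasCompactSupport W ∧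
      ContDiff ℝ (⊤ : ℕ∞) W ∧ (∀ v, W v ≠ 0 → |2 * Real.pi * v| ≤ T) ∧
      (∀ v, ‖W v‖ ^ 2 ≤ 2 * L ^ 2 * (1 + (L * v) ^ 2)⁻¹) ∧
      ∀ z, ‖(if z ∈ Set.Icc 0 L then (1 : ℂ) else 0) - 𝓕 W z‖ ≤
        C * ((1 + (T * z) ^ 2)⁻¹ + (1 + (T * (z - L)) ^ 2)⁻¹) := by
  obtain ⟨w, hw1, hws, hwc, hwi⟩ := exists_schwartz_bandlimited
  set φ : 𝓢(ℝ, ℂ) := 𝓕 w with hφ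
  have hφ1 : Integrable (fun r : ℝ => ‖φ r‖) := φ.integrable.norm
  have hφ2 : Integrable (fun r : ℝ => (1 + r ^ 2) * ‖φ r‖) := by
    have := φ.integrable_pow_mul volume 2
    refine (hφ1.add this).congr (.of_forall fun r => ?_)
    simp [add_mul]
  have hC0 : 0 ≤ ∫ r : ℝ, (1 + r ^ 2) * ‖φ r‖ := integral_nonneg fun r => by positivity
  refine ⟨(∫ r : ℝ, (1 + r ^ 2) * ‖φ r‖) + 1, by linarith, fun T L hT hL => ?_⟩
  refine ⟨fun v => w (T⁻¹ * v) * intervalKernel L v, ?_, ?_, ?_, ?_, fun z => ?_⟩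
  · exact (hwc.comp_homeomorph (Homeomorph.mulLeft₀ T⁻¹ (inv_ne_zero hT.ne'))).mul_right
  · exact ((w.smooth ⊤).comp (contDiff_const.mul contDiff_id)).mul (contDiff_intervalKernel L)
  · intro v hv
    have := hws _ (left_ne_zero_of_mul hv)
    rw [show 2 * Real.pi * (T⁻¹ * v) = (2 * Real.pi * v) / T by field_simp, abs_div,
      abs_of_pos hT, div_le_one hT] at this
    exact this
  · intro v
    refine le_trans ?_ (norm_intervalKernel_sq_le hL v)
    rw [norm_mul]
    gcongr
    exact mul_le_of_le_one_left (norm_nonneg _) (hw1 _)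
  · rw [fourier_comp_mul_intervalKernel w hT hL z]
    have e1 : ∫ r : ℝ, (T : ℂ) * φ (T * (z - r)) = 1 := by
      rw [integral_sub_left_eq_self (fun r : ℝ => (T : ℂ) * φ (T * r)) volume z,
        integral_const_mul, Measure.integral_comp_mul_left (fun r : ℝ => φ r) T, hwi,
        abs_of_pos (inv_pos.mpr hT), Complex.real_smul, mul_one]
      have : (T : ℂ) ≠ 0 := by exact_mod_cast hT.ne'
      push_cast
      field_simp
    have hi : Integrable (fun r : ℝ => (T : ℂ) * φ (T * (z - r))) :=
      (((φ.integrable (μ := volume)).comp_mul_left' hT.ne').const_mul (T : ℂ)).comp_sub_left z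
    set c : ℂ := if z ∈ Set.Icc 0 L then (1 : ℂ) else 0 with hc
    -- The smoothing kernel has mass one, so the error is an average of differences of indicators,
    -- bounded through the second moment of φ.
    have e2 : c = ∫ r : ℝ, c * ((T : ℂ) * φ (T * (z - r))) := by
      rw [integral_const_mul, e1, mul_one]
    rw [e2, ← integral_sub (hi.const_mul c) (hi.indicator measurableSet_Ioc)]
    have hi3 : Integrable (fun r : ℝ => T * ((1 + (T * (z - r)) ^ 2) * ‖φ (T * (z - r))‖)) :=
      ((hφ2.comp_mul_left' hT.ne').const_mul T).comp_sub_left z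
    set K := ((1 + (T * z) ^ 2)⁻¹ + (1 + (T * (z - L)) ^ 2)⁻¹) with hK
    have hK0 : 0 ≤ K := by positivity
    have e3 : ∫ r : ℝ, T * ((1 + (T * (z - r)) ^ 2) * ‖φ (T * (z - r))‖) =
        ∫ r : ℝ, (1 + r ^ 2) * ‖φ r‖ := by
      rw [integral_sub_left_eq_self
          (fun r : ℝ => T * ((1 + (T * r) ^ 2) * ‖φ (T * r)‖)) volume z,
        integral_const_mul,
        Measure.integral_comp_mul_left (fun r : ℝ => (1 + r ^ 2) * ‖φ r‖) T,
        abs_of_pos (inv_pos.mpr hT), smul_eq_mul]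
      field_simp
    calc _ ≤ ∫ r : ℝ, K * (T * ((1 + (T * (z - r)) ^ 2) * ‖φ (T * (z - r))‖)) := by
          refine norm_integral_le_of_norm_le (hi3.const_mul K) (.of_forall fun r => ?_)
          have := norm_indicator_sub_le (T := T) (L := L) (z := z) (r := r)
          rw [Set.indicator_apply]
          calc _ = ‖c - (if r ∈ Set.Ioc 0 L then (1 : ℂ) else 0)‖ * (T * ‖φ (T * (z - r))‖) := by
                have : ‖(T : ℂ) * φ (T * (z - r))‖ = T * ‖φ (T * (z - r))‖ := by
                  rw [norm_mul, Complex.norm_real, Real.norm_eq_abs, abs_of_pos hT]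
                rw [← this, ← norm_mul]
                congr 1
                split_ifs <;> ring
            _ ≤ ((1 + (T * (z - r)) ^ 2) * K) * (T * ‖φ (T * (z - r))‖) := by
                gcongr
            _ = _ := by ring
      _ = K * ∫ r : ℝ, (1 + r ^ 2) * ‖φ r‖ := by rw [integral_const_mul, e3]
      _ ≤ _ := by rw [mul_comm]; gcongr; linarith

/-! ### Harmonic sums of bumps on the logarithmic scale -/

theorem inv_one_add_sq_le_of_abs_sub_le_one {T : ℝ} (hT : 0 < T) (hT1 : T ≤ 1) {u a b : ℝ}
    (hab : |a - b| ≤ 1) :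
    (1 + (T * (a - u)) ^ 2)⁻¹ ≤ 3 * (1 + (T * (b - u)) ^ 2)⁻¹ := by
  rw [← div_eq_mul_inv, inv_eq_one_div, div_le_div_iff₀ (by positivity) (by positivity), one_mul]
  have h1 : (T * (a - b)) ^ 2 ≤ 1 := by
    rw [sq_le_one_iff_abs_le_one, abs_mul, abs_of_pos hT]
    exact mul_le_one₀ hT1 (abs_nonneg _) hab
  nlinarith [sq_nonneg (T * (a - u) + T * (a - b))]

theorem integrable_inv_one_add_mul_sub_sq {T : ℝ} (hT : 0 < T) (u : ℝ) :
    MeasureTheory.Integrable (fun w : ℝ => (1 + (T * (w - u)) ^ 2)⁻¹) :=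
  ((integrable_inv_one_add_sq.comp_mul_left' hT.ne')).comp_sub_right u

theorem integral_inv_one_add_mul_sub_sq {T : ℝ} (hT : 0 < T) (u : ℝ) :
    ∫ w : ℝ, (1 + (T * (w - u)) ^ 2)⁻¹ = Real.pi / T := by
  rw [MeasureTheory.integral_sub_right_eq_self (fun w : ℝ => (1 + (T * w) ^ 2)⁻¹) u,
    MeasureTheory.Measure.integral_comp_mul_left (fun v : ℝ => (1 + v ^ 2)⁻¹) T,
    integral_univ_inv_one_add_sq, abs_of_pos (inv_pos.mpr hT), smul_eq_mul]
  field_simp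

/-- With N = n + 1, the interval [log N, log(N+1)] has length at least 1/(2N) and at most 1; the
bump varies there by a factor at most 3, whence 6. -/
theorem inv_mul_le_integral_log {T : ℝ} (hT : 0 < T) (hT1 : T ≤ 1) (u : ℝ) (n : ℕ) :
    ((n + 1 : ℕ) : ℝ)⁻¹ * (1 + (T * (Real.log (n + 1 : ℕ) - u)) ^ 2)⁻¹ ≤
      6 * ∫ w in Real.log (n + 1 : ℕ)..Real.log (n + 1 + 1 : ℕ), (1 + (T * (w - u)) ^ 2)⁻¹ := by
  set N : ℝ := ((n + 1 : ℕ) : ℝ) with hN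
  have hN1 : 1 ≤ N := by rw [hN]; exact_mod_cast Nat.le_add_left 1 n
  have hN2 : ((n + 1 + 1 : ℕ) : ℝ) = N + 1 := by rw [hN]; push_cast; ring
  rw [hN2]
  have hle : Real.log N ≤ Real.log (N + 1) := Real.log_le_log (by linarith) (by linarith)
  have hdiff : Real.log (N + 1) - Real.log N = Real.log (1 + 1 / N) := by
    rw [← Real.log_div (by positivity) (by positivity)]; congr 1; field_simp
  have hlow : (2 * N)⁻¹ ≤ Real.log (N + 1) - Real.log N := by
    rw [hdiff]
    have := Real.one_sub_inv_le_log_of_pos (show 0 < 1 + 1 / N by positivity)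
    refine le_trans ?_ this
    have : 1 - (1 + 1 / N)⁻¹ = 1 / (N + 1) := by field_simp; ring
    rw [this, inv_eq_one_div]
    exact one_div_le_one_div_of_le (by positivity) (by linarith)
  have hup : Real.log (N + 1) - Real.log N ≤ 1 := by
    rw [hdiff]
    have := Real.log_le_sub_one_of_pos (show 0 < 1 + 1 / N by positivity)
    have h2 : 1 / N ≤ 1 := by rw [div_le_one (by linarith)]; exact hN1
    linarith
  have hmono : ∫ _w in Real.log N..Real.log (N + 1), (1 + (T * (Real.log N - u)) ^ 2)⁻¹ ≤
      ∫ w in Real.log N..Real.log (N + 1), 3 * (1 + (T * (w - u)) ^ 2)⁻¹ := by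
    refine intervalIntegral.integral_mono_on hle (by simp)
      ((integrable_inv_one_add_mul_sub_sq hT u).intervalIntegrable.const_mul 3) fun w hw => ?_
    exact inv_one_add_sq_le_of_abs_sub_le_one hT hT1 (by
      rw [abs_le]; constructor <;> linarith [hw.1, hw.2])
  rw [intervalIntegral.integral_const, intervalIntegral.integral_const_mul, smul_eq_mul] at hmono
  have h5 : (2 * N)⁻¹ * (1 + (T * (Real.log N - u)) ^ 2)⁻¹ ≤
      (Real.log (N + 1) - Real.log N) * (1 + (T * (Real.log N - u)) ^ 2)⁻¹ := by gcongr
  have h6 : N⁻¹ = 2 * (2 * N)⁻¹ := by field_simp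
  rw [h6]
  linarith

theorem sum_inv_mul_inv_one_add_sq_le {T : ℝ} (hT : 0 < T) (hT1 : T ≤ 1) (u : ℝ) (N : ℕ) :
    ∑ n ∈ range N, (n : ℝ)⁻¹ * (1 + (T * (Real.log n - u)) ^ 2)⁻¹ ≤ 6 * Real.pi / T := by
  have h0 : ∀ n : ℕ, 0 ≤ (n : ℝ)⁻¹ * (1 + (T * (Real.log n - u)) ^ 2)⁻¹ := fun n => by positivity
  have hi := integrable_inv_one_add_mul_sub_sq hT u
  calc _ ≤ ∑ n ∈ range (N + 1), (n : ℝ)⁻¹ * (1 + (T * (Real.log n - u)) ^ 2)⁻¹ :=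
        sum_le_sum_of_subset_of_nonneg (range_mono N.le_succ) fun n _ _ => h0 n
    _ = ∑ n ∈ range N,
          ((n + 1 : ℕ) : ℝ)⁻¹ * (1 + (T * (Real.log (n + 1 : ℕ) - u)) ^ 2)⁻¹ := by
        -- The term n = 0 vanishes because 0⁻¹ = 0.
        rw [sum_range_succ']; simp
    _ ≤ ∑ n ∈ range N, 6 * ∫ w in Real.log (n + 1 : ℕ)..Real.log (n + 1 + 1 : ℕ),
          (1 + (T * (w - u)) ^ 2)⁻¹ := sum_le_sum fun n _ => inv_mul_le_integral_log hT hT1 u n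
    _ = 6 * ∫ w in Real.log (0 + 1 : ℕ)..Real.log (N + 1 : ℕ), (1 + (T * (w - u)) ^ 2)⁻¹ := by
        rw [← mul_sum, intervalIntegral.sum_integral_adjacent_intervals
          (a := fun k : ℕ => Real.log (k + 1 : ℕ)) fun k _ => hi.intervalIntegrable]
    _ ≤ 6 * ∫ w : ℝ, (1 + (T * (w - u)) ^ 2)⁻¹ := by
        gcongr
        rw [intervalIntegral.integral_of_le
          (Real.log_le_log (by norm_num) (by exact_mod_cast Nat.succ_le_succ N.zero_le))]
        exact MeasureTheory.setIntegral_le_integral hi (.of_forall fun w => by positivity)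
    _ = _ := by rw [integral_inv_one_add_mul_sub_sq hT]; ring

theorem summable_inv_mul_inv_one_add_sq {T : ℝ} (hT : 0 < T) (hT1 : T ≤ 1) (u : ℝ) :
    Summable fun n : ℕ => (n : ℝ)⁻¹ * (1 + (T * (Real.log n - u)) ^ 2)⁻¹ :=
  summable_of_sum_range_le (fun n => by positivity) (sum_inv_mul_inv_one_add_sq_le hT hT1 u)

theorem tsum_inv_mul_inv_one_add_sq_le {T : ℝ} (hT : 0 < T) (hT1 : T ≤ 1) (u : ℝ) :
    ∑' n : ℕ, (n : ℝ)⁻¹ * (1 + (T * (Real.log n - u)) ^ 2)⁻¹ ≤ 6 * Real.pi / T :=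
  Real.tsum_le_of_sum_range_le (fun n => by positivity) (sum_inv_mul_inv_one_add_sq_le hT hT1 u)

/-! ### The L¹ mean of logarithmic sums -/

/-- The logarithmic partial sum `∑_{n ≤ z} g(n) / n`. -/
noncomputable def logSum (g : ℕ → ℂ) (z : ℝ) : ℂ := ∑ n ∈ Icc 1 ⌊z⌋₊, g n / (n : ℂ)

/-- Since log n ≥ 0 and u ≤ L, the upper end of the window never binds; the term n = 0 is a division
by zero. -/
theorem hasSum_logSum_exp (g : ℕ → ℂ) {L u : ℝ} (huL : u ≤ L) :
    HasSum (fun n : ℕ => g n / (n : ℂ) * (if u - Real.log n ∈ Set.Icc 0 L then (1 : ℂ) else 0))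
      (logSum g (Real.exp u)) := by
  have h : ∀ n : ℕ, n ∉ Icc 1 ⌊Real.exp u⌋₊ →
      g n / (n : ℂ) * (if u - Real.log n ∈ Set.Icc 0 L then (1 : ℂ) else 0) = 0 := by
    intro n hn
    rcases Nat.eq_zero_or_pos n with rfl | hpos
    · simp
    · rw [if_neg, mul_zero]
      intro h
      apply hn
      rw [mem_Icc]
      refine ⟨hpos, Nat.le_floor ?_⟩
      rw [← Real.log_le_iff_le_exp (by exact_mod_cast hpos)]
      linarith [h.1]
  have e := hasSum_sum_of_ne_finset_zero (L := SummationFilter.unconditional ℕ) h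
  convert! e using 1
  refine sum_congr rfl fun n hn => ?_
  rw [mem_Icc] at hn
  have hpos : (0 : ℝ) < n := by exact_mod_cast hn.1
  rw [if_pos, mul_one]
  refine ⟨?_, ?_⟩
  · rw [sub_nonneg, Real.log_le_iff_le_exp hpos]
    exact (Nat.le_floor_iff (Real.exp_pos u).le).mp hn.2
  · have : 0 ≤ Real.log n := Real.log_natCast_nonneg n
    linarith

-- Translation by log n is modulation on the Fourier side; absolute convergence permits summing
-- under the integral.
open FourierTransform MeasureTheory in
theorem hasSum_fourier_mul {g : ℕ → ℂ} (hs : Summable fun n : ℕ => ‖g n / (n : ℂ)‖) {F : ℝ → ℂ}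
    (hF : ∀ v : ℝ, HasSum (fun n : ℕ => g n / (n : ℂ) *
      Complex.exp ((2 * Real.pi * (v * Real.log n) : ℝ) * Complex.I)) (F v))
    {W : ℝ → ℂ} (hW : Integrable W) (u : ℝ) :
    HasSum (fun n : ℕ => g n / (n : ℂ) * 𝓕 W (u - Real.log n)) (𝓕 (fun v => W v * F v) u) := by
  let G : ℕ → ℝ → ℂ := fun n v => g n / (n : ℂ) *
    (Complex.exp ((-2 * Real.pi * (v * (u - Real.log n)) : ℝ) * Complex.I) * W v)
  have hGn : ∀ n v, ‖G n v‖ = ‖g n / (n : ℂ)‖ * ‖W v‖ := fun n v => by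
    simp only [G]
    rw [norm_mul, norm_mul, Complex.norm_exp_ofReal_mul_I, one_mul]
  have hGi : ∀ n, Integrable (G n) := fun n => by
    refine (Integrable.bdd_mul (c := 1) hW ?_ (.of_forall fun v => ?_)).const_mul _
    · exact Continuous.aestronglyMeasurable (by fun_prop)
    · rw [Complex.norm_exp_ofReal_mul_I]
  have key := hasSum_integral_of_summable_integral_norm hGi (by
    simp_rw [hGn, integral_const_mul]
    exact hs.mul_right _)
  convert! key using 1
  · funext n
    rw [Real.fourier_eq']
    simp only [G]
    rw [integral_const_mul]
    simp only [RCLike.inner_apply, conj_trivial, smul_eq_mul]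
    congr 1
    refine integral_congr_ae (.of_forall fun v => ?_)
    simp only
    rw [mul_comm v]
  · rw [Real.fourier_eq']
    refine integral_congr_ae (.of_forall fun v => ?_)
    simp only [RCLike.inner_apply, conj_trivial, smul_eq_mul]
    have := ((hF v).mul_left
      (Complex.exp ((-2 * Real.pi * (u * v) : ℝ) * Complex.I) * W v)).tsum_eq
    rw [← mul_assoc, ← this]
    refine tsum_congr fun n => ?_
    simp only [G]
    have : Complex.exp ((-2 * Real.pi * (v * (u - Real.log n)) : ℝ) * Complex.I) =
        Complex.exp ((-2 * Real.pi * (u * v) : ℝ) * Complex.I) *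
        Complex.exp ((2 * Real.pi * (v * Real.log n) : ℝ) * Complex.I) := by
      rw [← Complex.exp_add]; congr 1; push_cast; ring
    rw [this]; ring

-- The approximation error lives near log n = u and log n = u - L; each bump contributes 6π/T.
open FourierTransform MeasureTheory in
theorem norm_logSum_sub_fourier_le {g : ℕ → ℂ} (hg : ∀ n, ‖g n‖ ≤ 1)
    (hs : Summable fun n : ℕ => ‖g n / (n : ℂ)‖) {F : ℝ → ℂ}
    (hF : ∀ v : ℝ, HasSum (fun n : ℕ => g n / (n : ℂ) *
      Complex.exp ((2 * Real.pi * (v * Real.log n) : ℝ) * Complex.I)) (F v))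
    {W : ℝ → ℂ} (hW : Integrable W) {C T L u : ℝ} (hC : 0 ≤ C) (hT : 0 < T) (hT1 : T ≤ 1)
    (huL : u ≤ L)
    (hWC : ∀ z, ‖(if z ∈ Set.Icc 0 L then (1 : ℂ) else 0) - 𝓕 W z‖ ≤
        C * ((1 + (T * z) ^ 2)⁻¹ + (1 + (T * (z - L)) ^ 2)⁻¹)) :
    ‖logSum g (Real.exp u) - 𝓕 (fun v => W v * F v) u‖ ≤ C * (12 * Real.pi / T) := by
  have h := (hasSum_logSum_exp g huL).sub (hasSum_fourier_mul hs hF hW u)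
  rw [← h.tsum_eq]
  have hb := ((summable_inv_mul_inv_one_add_sq hT hT1 u).hasSum.add
    (summable_inv_mul_inv_one_add_sq hT hT1 (u - L)).hasSum).mul_left C
  refine (tsum_of_norm_bounded hb fun n => ?_).trans ?_
  · rw [← mul_sub, norm_mul, norm_div, Complex.norm_natCast]
    calc _ ≤ (1 / (n : ℝ)) * (C * ((1 + (T * (u - Real.log n)) ^ 2)⁻¹ +
          (1 + (T * (u - Real.log n - L)) ^ 2)⁻¹)) := by
          gcongr
          · exact hg n
          · exact hWC _
      _ = _ := by
          rw [show (T * (u - Real.log n)) ^ 2 = (T * (Real.log n - u)) ^ 2 by ring,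
            show (T * (u - Real.log n - L)) ^ 2 = (T * (Real.log n - (u - L))) ^ 2 by ring]
          ring
  · gcongr
    have h1 := tsum_inv_mul_inv_one_add_sq_le hT hT1 u
    have h2 := tsum_inv_mul_inv_one_add_sq_le hT hT1 (u - L)
    calc _ ≤ 6 * Real.pi / T + 6 * Real.pi / T := add_le_add h1 h2
      _ = _ := by ring

theorem measurable_logSum (g : ℕ → ℂ) : Measurable (logSum g) :=
  (measurable_from_nat (f := fun N : ℕ => ∑ n ∈ Icc 1 N, g n / (n : ℂ))).comp Nat.measurable_floor

theorem norm_logSum_le_of_le {g : ℕ → ℂ} (hg : ∀ n, ‖g n‖ ≤ 1) {u L : ℝ} (hu : u ≤ L) :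
    ‖logSum g (Real.exp u)‖ ≤ ⌊Real.exp L⌋₊ := by
  calc _ ≤ ∑ n ∈ Icc 1 ⌊Real.exp u⌋₊, (1 : ℝ) := by
        refine norm_sum_le_of_le _ fun n hn => ?_
        have : (1 : ℝ) ≤ n := by exact_mod_cast (mem_Icc.mp hn).1
        rw [norm_div, Complex.norm_natCast, div_le_one (by linarith)]
        exact (hg n).trans this
    _ ≤ _ := by
        simp only [sum_const, Nat.card_Icc, nsmul_eq_mul, mul_one, Nat.add_sub_cancel]
        exact_mod_cast Nat.floor_le_floor (Real.exp_le_exp.mpr hu)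

theorem intervalIntegrable_logSum_exp {g : ℕ → ℂ} (hg : ∀ n, ‖g n‖ ≤ 1) (a b : ℝ) :
    IntervalIntegrable (fun u => logSum g (Real.exp u)) MeasureTheory.volume a b := by
  rw [intervalIntegrable_iff]
  refine MeasureTheory.Measure.integrableOn_of_bounded (M := ⌊Real.exp (max a b)⌋₊)
    (by simp) ((measurable_logSum g).comp Real.measurable_exp).aestronglyMeasurable ?_
  refine (MeasureTheory.ae_restrict_iff' measurableSet_uIoc).mpr (.of_forall fun u hu => ?_)
  exact norm_logSum_le_of_le hg hu.2

open FourierTransform MeasureTheory SchwartzMap in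
theorem exists_integral_norm_logSum_exp_le :
    ∃ C : ℝ, 0 < C ∧ ∀ g : ℕ → ℂ, (∀ n, ‖g n‖ ≤ 1) →
      (Summable fun n : ℕ => ‖g n / (n : ℂ)‖) → ∀ F : ℝ → ℂ, ContDiff ℝ (⊤ : ℕ∞) F →
      (∀ v : ℝ, HasSum (fun n : ℕ => g n / (n : ℂ) *
        Complex.exp ((2 * Real.pi * (v * Real.log n) : ℝ) * Complex.I)) (F v)) →
      ∀ A T L : ℝ, 0 ≤ A → 0 < T → T ≤ 1 → 0 < L →
      (∀ v, |2 * Real.pi * v| ≤ T → ‖F v‖ ≤ A) →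
      ∫ u in (0 : ℝ)..L, ‖logSum g (Real.exp u)‖ ≤ C * (L * (A + 1 / T)) := by
  obtain ⟨C, hC, h⟩ := exists_bandlimited_approx
  refine ⟨2 * Real.pi + 1 + C * (12 * Real.pi), by positivity, ?_⟩
  intro g hg hs F hFc hF A T L hA hT hT1 hL hFA
  obtain ⟨W, hWc, hWd, hWs, hWn, hWa⟩ := h T L hT hL.le
  have hWi : Integrable W := hWd.continuous.integrable_of_hasCompactSupport hWc
  let H : 𝓢(ℝ, ℂ) := (hWc.mul_right (f' := F)).toSchwartzMap (hWd.mul hFc)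
  have hH : ∀ v, H v = W v * F v := fun v => rfl
  set B := A + 1 / T with hB
  have hBpos : 0 < B := by positivity
  obtain ⟨hmi, hmv⟩ := integral_norm_intervalKernel_sq_majorant hL
  have hL2 : ∫ u, ‖(𝓕 H) u‖ ^ 2 ≤ A ^ 2 * (2 * Real.pi * L) := by
    rw [SchwartzMap.integral_norm_sq_fourier, ← hmv, ← integral_const_mul]
    refine integral_mono_of_nonneg (.of_forall fun v => sq_nonneg _) (hmi.const_mul _)
      (.of_forall fun v => ?_)
    simp only [hH, norm_mul, mul_pow ‖W v‖]
    by_cases hv : W v = 0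
    · rw [hv]; rw [norm_zero, zero_pow two_ne_zero, zero_mul]; positivity
    · rw [mul_comm]
      gcongr
      · exact hFA v (hWs v hv)
      · exact hWn v
  have hi2 : Integrable (fun u => ‖(𝓕 H) u‖ ^ 2) := ((𝓕 H).memLp 2).integrable_norm_pow (by simp)
  have hint : IntervalIntegrable (fun u => ‖(𝓕 H) u‖ ^ 2 * (1 / B) + B) volume 0 L :=
    (hi2.intervalIntegrable.mul_const _).add (by simp)
  have hHcoe : ∀ u, (𝓕 H) u = 𝓕 (fun v => W v * F v) u := fun u => by
    rw [SchwartzMap.fourier_coe]; rfl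
  calc ∫ u in (0 : ℝ)..L, ‖logSum g (Real.exp u)‖
      ≤ ∫ u in (0 : ℝ)..L, ((‖(𝓕 H) u‖ ^ 2 * (1 / B) + B) + C * (12 * Real.pi / T)) := by
        refine intervalIntegral.integral_mono_on hL.le (intervalIntegrable_logSum_exp hg 0 L).norm
          (hint.add (by simp)) fun u hu => ?_
        have h1 := norm_logSum_sub_fourier_le hg hs hF hWi hC.le hT hT1 hu.2 hWa
        rw [← hHcoe] at h1
        -- Plays the role of Cauchy–Schwarz: with A ≤ B the integrated square costs only O(LB).
        have h2 : ‖(𝓕 H) u‖ ≤ ‖(𝓕 H) u‖ ^ 2 * (1 / B) + B := by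
          rw [mul_one_div, ← sub_le_iff_le_add, le_div_iff₀ hBpos]
          nlinarith [sq_nonneg (‖(𝓕 H) u‖ - B), norm_nonneg ((𝓕 H) u)]
        have h3 := norm_le_norm_add_norm_sub' (logSum g (Real.exp u)) ((𝓕 H) u)
        linarith
    _ = (∫ u in (0 : ℝ)..L, ‖(𝓕 H) u‖ ^ 2) * (1 / B) + L * B + L * (C * (12 * Real.pi / T)) := by
        rw [intervalIntegral.integral_add hint (by simp),
          intervalIntegral.integral_add (hi2.intervalIntegrable.mul_const _) (by simp),
          intervalIntegral.integral_mul_const, intervalIntegral.integral_const,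
          intervalIntegral.integral_const]
        simp
    _ ≤ (A ^ 2 * (2 * Real.pi * L)) * (1 / B) + L * B + L * (C * (12 * Real.pi / T)) := by
        gcongr
        refine le_trans ?_ hL2
        rw [intervalIntegral.integral_of_le hL.le]
        exact setIntegral_le_integral hi2 (.of_forall fun u => by positivity)
    _ ≤ (2 * Real.pi * L) * B + L * B + L * (C * (12 * Real.pi)) * B := by
        have hAB : A ≤ B := by rw [hB]; have : 0 < 1 / T := by positivity
                               linarith
        have hTB : 1 / T ≤ B := by rw [hB]; linarith
        gcongr ?_ + _ + ?_
        · rw [mul_one_div, div_le_iff₀ hBpos]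
          have : A ^ 2 ≤ B ^ 2 := by gcongr
          have h0 : 0 ≤ 2 * Real.pi * L := by positivity
          nlinarith
        · calc _ = L * (C * (12 * Real.pi)) * (1 / T) := by ring
            _ ≤ _ := by gcongr
    _ = _ := by ring

/-! ### From the mean to a pointwise bound -/

open MeasureTheory in
theorem integral_indicator_Ici {a L : ℝ} (ha : 0 ≤ a) (haL : a ≤ L) (c : ℂ) :
    ∫ u in (0 : ℝ)..L, (Set.Ici a).indicator (fun _ => c) u = c * (L - a) := by
  rw [intervalIntegral.integral_of_le (ha.trans haL), setIntegral_indicator measurableSet_Ici]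
  have h : (Set.Ioc 0 L ∩ Set.Ici a : Set ℝ) =ᵐ[volume] Set.Ioc a L := by
    have h1 := (ae_eq_refl (μ := volume) (Set.Ioc 0 L : Set ℝ)).inter
      (Ioi_ae_eq_Ici (μ := volume) (a := a)).symm
    rwa [Set.Ioc_inter_Ioi, max_eq_right ha] at h1
  rw [setIntegral_congr_set h, ← intervalIntegral.integral_of_le haL]
  simp [mul_comm]

/-- log x - log n is the length of the set of u in [0, log x] at which n is counted. -/
theorem sum_mul_log_sub_log_eq_integral (g : ℕ → ℂ) {x : ℝ} (hx : 1 ≤ x) :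
    ∑ n ∈ Icc 1 ⌊x⌋₊, g n / (n : ℂ) * (Real.log x - Real.log n) =
      ∫ u in (0 : ℝ)..Real.log x, logSum g (Real.exp u) := by
  have hx0 : 0 < x := by linarith
  have h1 : ∫ u in (0 : ℝ)..Real.log x, logSum g (Real.exp u) =
      ∫ u in (0 : ℝ)..Real.log x, ∑ n ∈ Icc 1 ⌊x⌋₊,
        (Set.Ici (Real.log n)).indicator (fun _ => g n / (n : ℂ)) u := by
    refine intervalIntegral.integral_congr fun u hu => ?_
    rw [Set.uIcc_of_le (Real.log_nonneg hx)] at hu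
    simp only [logSum, Set.indicator_apply, Set.mem_Ici]
    rw [← sum_filter]
    refine sum_congr ?_ fun _ _ => rfl
    ext n
    simp only [mem_Icc, mem_filter]
    have hxu : Real.exp u ≤ x := by rw [← Real.le_log_iff_exp_le hx0]; exact hu.2
    constructor
    · rintro ⟨h1, h2⟩
      refine ⟨⟨h1, h2.trans (Nat.floor_le_floor hxu)⟩, ?_⟩
      rw [Real.log_le_iff_le_exp (by exact_mod_cast h1)]
      exact (Nat.le_floor_iff (Real.exp_pos u).le).mp h2
    · rintro ⟨⟨h1, -⟩, h2⟩
      refine ⟨h1, Nat.le_floor ?_⟩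
      rwa [Real.log_le_iff_le_exp (by exact_mod_cast h1)] at h2
  rw [h1, intervalIntegral.integral_finsetSum]
  · refine sum_congr rfl fun n hn => ?_
    rw [mem_Icc] at hn
    rw [integral_indicator_Ici (Real.log_natCast_nonneg n)]
    refine Real.log_le_log (by exact_mod_cast hn.1) ?_
    exact (Nat.le_floor_iff hx0.le).mp hn.2
  · intro n _
    rw [intervalIntegrable_iff]
    exact (MeasureTheory.integrableOn_const (by simp)).indicator measurableSet_Ici

-- Sums the identity log = Λ * 1, twisted by the completely multiplicative g.
open ArithmeticFunction in
theorem sum_mul_log_eq_sum_vonMangoldt {g : ℕ → ℂ}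
    (hmul : ∀ m n : ℕ, 1 ≤ m → 1 ≤ n → g (m * n) = g m * g n) (x : ℝ) :
    ∑ n ∈ Icc 1 ⌊x⌋₊, g n / (n : ℂ) * Real.log n =
      ∑ d ∈ Icc 1 ⌊x⌋₊, (vonMangoldt d : ℂ) * (g d / (d : ℂ)) * logSum g (x / d) := by
  let a : ArithmeticFunction ℂ := ⟨fun d => (vonMangoldt d : ℂ) * (g d / (d : ℂ)), by simp⟩
  let b : ArithmeticFunction ℂ := ⟨fun n => g n / (n : ℂ), by simp⟩
  have h := sum_Ioc_mul_eq_sum_sum a b ⌊x⌋₊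
  have hIoc : ∀ N : ℕ, Ioc 0 N = Icc 1 N := fun N => rfl
  simp only [hIoc] at h
  convert! h using 1
  · refine sum_congr rfl fun n hn => ?_
    rw [mem_Icc] at hn
    rw [ArithmeticFunction.mul_apply, ← vonMangoldt_sum, Complex.ofReal_sum, mul_sum,
      Nat.sum_divisorsAntidiagonal (fun i _ => g n / (n : ℂ) * (vonMangoldt i : ℂ)) |>.symm]
    refine sum_congr rfl fun p hp => ?_
    rw [Nat.mem_divisorsAntidiagonal] at hp
    have hp1 : 1 ≤ p.1 := Nat.pos_of_ne_zero fun h0 => hp.2 (by rw [← hp.1, h0, zero_mul])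
    have hp2 : 1 ≤ p.2 := Nat.pos_of_ne_zero fun h0 => hp.2 (by rw [← hp.1, h0, mul_zero])
    change _ = (vonMangoldt p.1 : ℂ) * (g p.1 / (p.1 : ℂ)) * (g p.2 / (p.2 : ℂ))
    rw [← hp.1, hmul _ _ hp1 hp2]
    push_cast
    have h1 : (p.1 : ℂ) ≠ 0 := by exact_mod_cast (Nat.one_le_iff_ne_zero.mp hp1)
    have h2 : (p.2 : ℂ) ≠ 0 := by exact_mod_cast (Nat.one_le_iff_ne_zero.mp hp2)
    field_simp
  · refine sum_congr rfl fun d hd => ?_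
    rw [logSum, Nat.floor_div_natCast]
    rfl

/-- The bump with T = 1 is at least 1/2 on the window between u' and u, so twice its sum, 2 · 6π,
dominates. -/
theorem norm_logSum_exp_sub_le_of_le {g : ℕ → ℂ} (hg : ∀ n, ‖g n‖ ≤ 1) {u u' : ℝ} (h : u' ≤ u)
    (h1 : u ≤ u' + 1) :
    ‖logSum g (Real.exp u) - logSum g (Real.exp u')‖ ≤ 12 * Real.pi := by
  have hsub : Icc 1 ⌊Real.exp u'⌋₊ ⊆ Icc 1 ⌊Real.exp u⌋₊ :=
    Icc_subset_Icc_right (Nat.floor_le_floor (Real.exp_le_exp.mpr h))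
  rw [logSum, logSum, ← sum_sdiff hsub, add_sub_cancel_right]
  have hs := summable_inv_mul_inv_one_add_sq one_pos le_rfl u
  have ht := tsum_inv_mul_inv_one_add_sq_le one_pos le_rfl u
  calc _ ≤ ∑ n ∈ Icc 1 ⌊Real.exp u⌋₊ \ Icc 1 ⌊Real.exp u'⌋₊,
        2 * ((n : ℝ)⁻¹ * (1 + (1 * (Real.log n - u)) ^ 2)⁻¹) := by
        refine norm_sum_le_of_le _ fun n hn => ?_
        simp only [mem_sdiff, mem_Icc, not_and, not_le] at hn
        obtain ⟨⟨hn1, hn2⟩, hn3⟩ := hn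
        have hpos : (0 : ℝ) < n := by exact_mod_cast hn1
        have l1 : Real.log n ≤ u := by
          rw [Real.log_le_iff_le_exp hpos]
          exact (Nat.le_floor_iff (Real.exp_pos u).le).mp hn2
        have l2 : u' ≤ Real.log n := by
          rw [Real.le_log_iff_exp_le hpos]
          exact ((Nat.floor_lt (Real.exp_pos u').le).mp (hn3 hn1)).le
        have l3 : (1 * (Real.log n - u)) ^ 2 ≤ 1 := by
          rw [sq_le_one_iff_abs_le_one, abs_le]; constructor <;> linarith
        have l4 : 1 ≤ 2 * (1 + (1 * (Real.log n - u)) ^ 2)⁻¹ := by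
          rw [← div_eq_mul_inv, le_div_iff₀ (by positivity)]; linarith
        rw [norm_div, Complex.norm_natCast, div_eq_mul_inv]
        calc _ ≤ 1 * (n : ℝ)⁻¹ := by gcongr; exact hg n
          _ ≤ (2 * (1 + (1 * (Real.log n - u)) ^ 2)⁻¹) * (n : ℝ)⁻¹ := by gcongr
          _ = _ := by ring
    _ ≤ 2 * ∑' n : ℕ, ((n : ℝ)⁻¹ * (1 + (1 * (Real.log n - u)) ^ 2)⁻¹) := by
        rw [← mul_sum]
        gcongr
        exact hs.sum_le_tsum _ fun n _ => by positivity
    _ ≤ _ := by linarith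

theorem norm_logSum_exp_sub_le {g : ℕ → ℂ} (hg : ∀ n, ‖g n‖ ≤ 1) {u u' : ℝ}
    (h : |u - u'| ≤ 1) :
    ‖logSum g (Real.exp u) - logSum g (Real.exp u')‖ ≤ 12 * Real.pi := by
  rw [abs_le] at h
  rcases le_total u' u with h' | h'
  · exact norm_logSum_exp_sub_le_of_le hg h' (by linarith)
  · rw [norm_sub_rev]
    exact norm_logSum_exp_sub_le_of_le hg h' (by linarith)

-- On the block e^j ≤ d < e^(j+1), 1/d ≤ e^(-j), and Chebyshev bounds ψ(e^(j+1)).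
open ArithmeticFunction in
theorem sum_vonMangoldt_div_le (s : Finset ℕ) (j : ℕ)
    (hs : ∀ d ∈ s, 1 ≤ d ∧ ⌊Real.log d⌋₊ = j) :
    ∑ d ∈ s, vonMangoldt d / (d : ℝ) ≤ Real.exp 1 * (Real.log 4 + 4) := by
  have hE : Real.exp (j + 1) = Real.exp j * Real.exp 1 := Real.exp_add _ _
  calc _ ≤ ∑ d ∈ s, vonMangoldt d * (Real.exp j)⁻¹ := by
        refine sum_le_sum fun d hd => ?_
        obtain ⟨h1, h2⟩ := hs d hd
        rw [div_eq_mul_inv]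
        gcongr
        · rw [← Real.le_log_iff_exp_le (by exact_mod_cast h1), ← h2]
          exact Nat.floor_le (Real.log_natCast_nonneg d)
    _ ≤ Chebyshev.psi (Real.exp (j + 1)) * (Real.exp j)⁻¹ := by
        rw [← sum_mul]
        gcongr
        rw [Chebyshev.psi]
        refine sum_le_sum_of_subset_of_nonneg (fun d hd => ?_) fun _ _ _ => vonMangoldt_nonneg
        obtain ⟨h1, h2⟩ := hs d hd
        rw [mem_Ioc]
        refine ⟨h1, Nat.le_floor ?_⟩
        rw [← Real.log_le_iff_le_exp (by exact_mod_cast h1), ← h2]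
        exact (Nat.lt_floor_add_one _).le
    _ ≤ ((Real.log 4 + 4) * Real.exp (j + 1)) * (Real.exp j)⁻¹ := by
        gcongr
        exact Chebyshev.psi_le_const_mul_self (Real.exp_pos _).le
    _ = _ := by rw [hE]; field_simp

-- For log d in [j, j+1), slow variation replaces the value at x/d by an average over that unit
-- interval; each block then has bounded Λ(d)/d mass.
open ArithmeticFunction MeasureTheory in
theorem sum_vonMangoldt_mul_norm_logSum_le {g : ℕ → ℂ} (hg : ∀ n, ‖g n‖ ≤ 1) {x : ℝ}
    (hx : 1 ≤ x) :
    ∑ d ∈ Icc 1 ⌊x⌋₊, vonMangoldt d / (d : ℝ) * ‖logSum g (x / d)‖ ≤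
      Real.exp 1 * (Real.log 4 + 4) * ((∫ u in (0 : ℝ)..Real.log x, ‖logSum g (Real.exp u)‖) +
        12 * Real.pi * (Real.log x + 1)) := by
  have hx0 : 0 < x := by linarith
  set L := Real.log x with hL
  have hL0 : 0 ≤ L := Real.log_nonneg hx
  set J := ⌊L⌋₊ with hJ
  set c := Real.exp 1 * (Real.log 4 + 4) with hc
  let B : ℝ → ℝ := fun u => ‖logSum g (Real.exp u)‖
  have hBi : ∀ a b, IntervalIntegrable B volume a b := fun a b =>
    (intervalIntegrable_logSum_exp hg a b).norm
  let I : ℕ → ℝ := fun j => ∫ r in (j : ℝ)..(j + 1 : ℕ), B (L - r)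
  have hBi' : ∀ a b, IntervalIntegrable (fun r => B (L - r)) volume a b := fun a b => by
    simpa using (hBi (L - a) (L - b)).comp_sub_left L
  have hI0 : ∀ j, 0 ≤ I j := fun j =>
    intervalIntegral.integral_nonneg (by simp) fun r _ => norm_nonneg _
  have hpt : ∀ d ∈ Icc 1 ⌊x⌋₊, ‖logSum g (x / d)‖ ≤ I ⌊Real.log d⌋₊ + 12 * Real.pi := by
    intro d hd
    rw [mem_Icc] at hd
    have hd0 : (0 : ℝ) < d := by exact_mod_cast hd.1
    have e : x / d = Real.exp (L - Real.log d) := by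
      rw [Real.exp_sub, hL, Real.exp_log hx0, Real.exp_log hd0]
    rw [e]
    have f1 := Nat.floor_le (Real.log_natCast_nonneg d)
    have f2 := Nat.lt_floor_add_one (Real.log d)
    set j := ⌊Real.log d⌋₊
    have : ∫ _r in (j : ℝ)..(j + 1 : ℕ), (B (L - Real.log d) - 12 * Real.pi) ≤ I j := by
      refine intervalIntegral.integral_mono_on (by simp) (by simp) (hBi' _ _) fun r hr => ?_
      have hr2 := hr.2
      push_cast at hr2
      have := norm_logSum_exp_sub_le hg (u := L - Real.log d) (u' := L - r)
        (by rw [abs_le]; constructor <;> linarith [hr.1])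
      have h3 := norm_le_norm_add_norm_sub' (logSum g (Real.exp (L - Real.log d)))
        (logSum g (Real.exp (L - r)))
      simp only [B]
      linarith
    rw [intervalIntegral.integral_const] at this
    push_cast at this
    simp only [add_sub_cancel_left, one_smul] at this
    simp only [B] at this
    linarith
  have hmaps : ∀ d ∈ Icc 1 ⌊x⌋₊, ⌊Real.log d⌋₊ ∈ range (J + 1) := by
    intro d hd
    rw [mem_Icc] at hd
    rw [mem_range, Nat.lt_succ_iff]
    exact Nat.floor_le_floor (Real.log_le_log (by exact_mod_cast hd.1)
      ((Nat.le_floor_iff hx0.le).mp hd.2))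
  have hsumI : ∑ j ∈ range (J + 1), I j = ∫ u in (0 : ℝ)..L, B u := by
    have h1 := intervalIntegral.sum_integral_adjacent_intervals (f := fun r => B (L - r))
      (μ := volume) (a := fun k : ℕ => (k : ℝ)) (n := J + 1) fun k _ => hBi' _ _
    simp only [I]
    rw [h1, intervalIntegral.integral_comp_sub_left B L, Nat.cast_zero, sub_zero,
      ← intervalIntegral.integral_add_adjacent_intervals (hBi _ 0) (hBi 0 L)]
    have hneg : L - (J + 1 : ℕ) ≤ 0 := by
      have := (Nat.lt_floor_add_one L).le
      push_cast
      linarith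
    -- The last block overshoots into u < 0, where e^u < 1 and the sum is empty.
    have h0 : ∫ u in (L - (J + 1 : ℕ))..0, B u = 0 := by
      rw [intervalIntegral.integral_of_le hneg, integral_Ioc_eq_integral_Ioo]
      refine setIntegral_eq_zero_of_forall_eq_zero fun u hu => ?_
      have : ⌊Real.exp u⌋₊ = 0 := Nat.floor_eq_zero.mpr (by
        rw [← Real.exp_zero]; exact Real.exp_lt_exp.mpr hu.2)
      simp [B, logSum, this]
    rw [h0, zero_add]
  calc _ ≤ ∑ d ∈ Icc 1 ⌊x⌋₊, vonMangoldt d / (d : ℝ) * (I ⌊Real.log d⌋₊ + 12 * Real.pi) := by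
        refine sum_le_sum fun d hd => ?_
        gcongr
        exact hpt d hd
    _ = ∑ j ∈ range (J + 1), ∑ d ∈ Icc 1 ⌊x⌋₊ with ⌊Real.log (d : ℕ)⌋₊ = j,
          vonMangoldt d / (d : ℝ) * (I ⌊Real.log d⌋₊ + 12 * Real.pi) :=
        (sum_fiberwise_of_maps_to hmaps _).symm
    _ ≤ ∑ j ∈ range (J + 1), c * (I j + 12 * Real.pi) := by
        refine sum_le_sum fun j _ => ?_
        have : ∑ d ∈ Icc 1 ⌊x⌋₊ with ⌊Real.log (d : ℕ)⌋₊ = j,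
            vonMangoldt d / (d : ℝ) * (I ⌊Real.log d⌋₊ + 12 * Real.pi) =
            (∑ d ∈ Icc 1 ⌊x⌋₊ with ⌊Real.log (d : ℕ)⌋₊ = j, vonMangoldt d / (d : ℝ)) *
              (I j + 12 * Real.pi) := by
          rw [sum_mul]
          exact sum_congr rfl fun d hd => by rw [(mem_filter.mp hd).2]
        rw [this]
        have := hI0 j
        gcongr
        refine sum_vonMangoldt_div_le _ j fun d hd => ?_
        rw [mem_filter, mem_Icc] at hd
        exact ⟨hd.1.1, hd.2⟩
    _ = c * ((∫ u in (0 : ℝ)..L, B u) + 12 * Real.pi * (J + 1)) := by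
        rw [← mul_sum, sum_add_distrib, hsumI, sum_const, card_range, nsmul_eq_mul]
        push_cast
        ring
    _ ≤ _ := by
        have : (J : ℝ) ≤ L := Nat.floor_le hL0
        have hc0 : 0 ≤ c := by
          have := Real.log_nonneg (show (1 : ℝ) ≤ 4 by norm_num)
          positivity
        gcongr

/-- Halász's inequality for logarithmic means, for a completely multiplicative function whose
Dirichlet series converges absolutely on the line `Re s = 1`. -/
theorem exists_norm_logSum_le :
    ∃ C : ℝ, 0 < C ∧ ∀ g : ℕ → ℂ, (∀ n, ‖g n‖ ≤ 1) →
      (∀ m n : ℕ, 1 ≤ m → 1 ≤ n → g (m * n) = g m * g n) →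
      (Summable fun n : ℕ => ‖g n / (n : ℂ)‖) → ∀ F : ℝ → ℂ, ContDiff ℝ (⊤ : ℕ∞) F →
      (∀ v : ℝ, HasSum (fun n : ℕ => g n / (n : ℂ) *
        Complex.exp ((2 * Real.pi * (v * Real.log n) : ℝ) * Complex.I)) (F v)) →
      ∀ A T x : ℝ, 0 ≤ A → 0 < T → T ≤ 1 → 2 ≤ x →
      (∀ v, |2 * Real.pi * v| ≤ T → ‖F v‖ ≤ A) →
      ‖logSum g x‖ ≤ C * (A + 1 / T) := by
  obtain ⟨C, hC, h⟩ := exists_integral_norm_logSum_exp_le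
  set c := Real.exp 1 * (Real.log 4 + 4) with hc
  have hc0 : 0 < c := by
    have := Real.log_nonneg (show (1 : ℝ) ≤ 4 by norm_num)
    positivity
  refine ⟨C + c * (C + 12 * Real.pi * 3), by positivity, ?_⟩
  intro g hg hmul hs F hFc hF A T x hA hT hT1 hx hFA
  have hx1 : 1 ≤ x := by linarith
  have hx0 : 0 < x := by linarith
  set L := Real.log x with hL
  -- Gives L + 1 ≤ 3L, the source of the 3 in the constant.
  have hL2 : 1 / 2 ≤ L := by
    have := Real.log_le_log two_pos hx
    linarith [Real.log_two_gt_d9]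
  have hL0 : 0 < L := by linarith
  have hI := h g hg hs F hFc hF A T L hA hT hT1 hL0 hFA
  set I := ∫ u in (0 : ℝ)..L, ‖logSum g (Real.exp u)‖ with hIdef
  have hB : 1 ≤ A + 1 / T := by
    have : 1 ≤ 1 / T := by rw [le_div_iff₀ hT]; linarith
    linarith
  -- Splits log x = (log x - log n) + log n termwise.
  have e : (L : ℂ) * logSum g x = (∫ u in (0 : ℝ)..L, logSum g (Real.exp u)) +
      ∑ d ∈ Icc 1 ⌊x⌋₊, (ArithmeticFunction.vonMangoldt d : ℂ) * (g d / (d : ℂ)) *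
        logSum g (x / d) := by
    rw [← sum_mul_log_sub_log_eq_integral g hx1, ← sum_mul_log_eq_sum_vonMangoldt hmul,
      ← sum_add_distrib, logSum, mul_sum]
    exact sum_congr rfl fun n _ => by ring
  have e1 : ‖∫ u in (0 : ℝ)..L, logSum g (Real.exp u)‖ ≤ I :=
    intervalIntegral.norm_integral_le_integral_norm hL0.le
  have e2 : ‖∑ d ∈ Icc 1 ⌊x⌋₊, (ArithmeticFunction.vonMangoldt d : ℂ) * (g d / (d : ℂ)) *
        logSum g (x / d)‖ ≤ c * (I + 12 * Real.pi * (L + 1)) := by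
    refine le_trans ?_ (sum_vonMangoldt_mul_norm_logSum_le hg hx1)
    refine norm_sum_le_of_le _ fun d _ => ?_
    rw [norm_mul, norm_mul, norm_div, Complex.norm_natCast, Complex.norm_real, Real.norm_eq_abs,
      abs_of_nonneg ArithmeticFunction.vonMangoldt_nonneg, mul_div_assoc']
    gcongr
    exact mul_le_of_le_one_right ArithmeticFunction.vonMangoldt_nonneg (hg d)
  have key : L * ‖logSum g x‖ ≤ L * ((C + c * (C + 12 * Real.pi * 3)) * (A + 1 / T)) := by
    calc L * ‖logSum g x‖ = ‖(L : ℂ) * logSum g x‖ := by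
          rw [norm_mul, Complex.norm_real, Real.norm_eq_abs, abs_of_pos hL0]
      _ ≤ I + c * (I + 12 * Real.pi * (L + 1)) := by
          rw [e]; exact (norm_add_le _ _).trans (add_le_add e1 e2)
      _ ≤ C * (L * (A + 1 / T)) + c * (C * (L * (A + 1 / T)) +
            12 * Real.pi * (3 * L * (A + 1 / T))) := by
          gcongr
          nlinarith
      _ = _ := by ring
  exact le_of_mul_le_mul_left key hL0

/-! ### Mertens-type upper bounds -/

-- ∑ Λ(d)⌊N/d⌋ = log N! ≤ N log N, and N/d ≤ 2⌊N/d⌋ for d ≤ N.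
open ArithmeticFunction in
theorem sum_vonMangoldt_div_le_two_mul_log {N : ℕ} (hN : 1 ≤ N) :
    ∑ d ∈ Icc 1 N, vonMangoldt d / (d : ℝ) ≤ 2 * Real.log N := by
  have hN0 : (0 : ℝ) < N := by exact_mod_cast hN
  have h := sum_Ioc_mul_zeta_eq_sum vonMangoldt N
  rw [vonMangoldt_mul_zeta] at h
  have hIoc : Ioc 0 N = Icc 1 N := rfl
  rw [hIoc] at h
  have h1 : ∑ n ∈ Icc 1 N, log n ≤ N * Real.log N := by
    calc _ ≤ ∑ n ∈ Icc 1 N, Real.log N := by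
          refine sum_le_sum fun n hn => ?_
          rw [mem_Icc] at hn
          exact Real.log_le_log (by exact_mod_cast hn.1) (by exact_mod_cast hn.2)
      _ = _ := by simp
  have h2 : (N : ℝ) / 2 * ∑ d ∈ Icc 1 N, vonMangoldt d / (d : ℝ) ≤
      ∑ d ∈ Icc 1 N, vonMangoldt d * ((N / d : ℕ) : ℝ) := by
    rw [mul_sum]
    refine sum_le_sum fun d hd => ?_
    rw [mem_Icc] at hd
    have hd0 : (0 : ℝ) < d := by exact_mod_cast hd.1
    have h3 : 1 ≤ N / d := (Nat.one_le_div_iff hd.1).mpr hd.2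
    have h4 : (N : ℝ) < d * ((N / d : ℕ) + 1 : ℕ) := by
      exact_mod_cast Nat.lt_mul_div_succ N hd.1
    have h5 : (1 : ℝ) ≤ (N / d : ℕ) := by exact_mod_cast h3
    have h6 : (N : ℝ) / 2 / d ≤ (N / d : ℕ) := by
      rw [div_le_iff₀ hd0]
      push_cast at h4
      nlinarith
    calc _ = vonMangoldt d * ((N : ℝ) / 2 / d) := by ring
      _ ≤ _ := by gcongr
  have h7 : (N : ℝ) / 2 * ∑ d ∈ Icc 1 N, vonMangoldt d / (d : ℝ) ≤
      (N : ℝ) / 2 * (2 * Real.log N) := by linarith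
  exact le_of_mul_le_mul_left h7 (by positivity)

theorem sum_prime_log_div_le {y : ℝ} (hy : 1 ≤ y) :
    ∑ p ∈ Icc 1 ⌊y⌋₊ with p.Prime, Real.log p / (p : ℝ) ≤ 2 * Real.log y := by
  have hN : 1 ≤ ⌊y⌋₊ := Nat.le_floor (by exact_mod_cast hy)
  calc _ = ∑ p ∈ Icc 1 ⌊y⌋₊ with p.Prime, ArithmeticFunction.vonMangoldt p / (p : ℝ) :=
        sum_congr rfl fun p hp => by
          rw [ArithmeticFunction.vonMangoldt_apply_prime (mem_filter.mp hp).2]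
    _ ≤ ∑ d ∈ Icc 1 ⌊y⌋₊, ArithmeticFunction.vonMangoldt d / (d : ℝ) :=
        sum_le_sum_of_subset_of_nonneg (filter_subset _ _) fun d _ _ =>
          div_nonneg ArithmeticFunction.vonMangoldt_nonneg (Nat.cast_nonneg d)
    _ ≤ 2 * Real.log ⌊y⌋₊ := sum_vonMangoldt_div_le_two_mul_log hN
    _ ≤ _ := by
        gcongr
        exact Nat.floor_le (by linarith)

theorem tsum_rpow_neg_one_sub_le {σ : ℝ} (hσ : 0 < σ) :
    ∑' n : ℕ, (n : ℝ) ^ (-(1 + σ)) ≤ 1 + 1 / σ := by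
  have hnn : ∀ n : ℕ, 0 ≤ (n : ℝ) ^ (-(1 + σ)) := fun n => by positivity
  refine Real.tsum_le_of_sum_range_le hnn fun N => ?_
  have hanti : AntitoneOn (fun x : ℝ => x ^ (-(1 + σ))) (Set.Icc 1 (1 + (N : ℕ))) := by
    intro a ha b hb hab
    exact Real.rpow_le_rpow_of_nonpos (by linarith [ha.1]) hab (by linarith)
  have h := hanti.sum_le_integral
  have hN : (1 : ℝ) ≤ 1 + N := by linarith [(Nat.cast_nonneg N : (0 : ℝ) ≤ N)]
  rw [integral_rpow (Or.inr ⟨by linarith, by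
    rw [Set.uIcc_of_le hN]; intro h0; linarith [h0.1]⟩)] at h
  have h2 : ((1 + (N : ℝ)) ^ (-(1 + σ) + 1) - 1 ^ (-(1 + σ) + 1)) / (-(1 + σ) + 1) ≤ 1 / σ := by
    have e : -(1 + σ) + 1 = -σ := by ring
    rw [e, Real.one_rpow, div_neg, ← neg_div, neg_sub]
    gcongr
    have : 0 ≤ (1 + (N : ℝ)) ^ (-σ) := by positivity
    linarith
  calc _ ≤ ∑ n ∈ range (N + 2), (n : ℝ) ^ (-(1 + σ)) :=
        sum_le_sum_of_subset_of_nonneg (range_mono (by lia)) fun n _ _ => hnn n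
    _ = ∑ i ∈ range N, (1 + ((i + 1 : ℕ) : ℝ)) ^ (-(1 + σ)) + 1 := by
        rw [sum_range_succ', sum_range_succ']
        have : (-(1 + σ)) ≠ 0 := by linarith
        simp only [Nat.cast_zero, Real.zero_rpow this, zero_add, add_zero, Nat.cast_one,
          Real.one_rpow]
        congr 1
        refine sum_congr rfl fun i _ => ?_
        push_cast
        ring_nf
    _ ≤ _ := by linarith

/-- The upper bound in Mertens' second theorem. -/
theorem sum_prime_inv_le {y : ℝ} (hy : 2 ≤ y) :
    ∑ p ∈ Icc 1 ⌊y⌋₊ with p.Prime, 1 / (p : ℝ) ≤ Real.log (Real.log y) + 4 := by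
  have hlog : 1 / 2 < Real.log y := by
    have := Real.log_le_log two_pos hy
    linarith [Real.log_two_gt_d9]
  have hlog0 : 0 < Real.log y := by linarith
  -- Rankin's shift: the Euler product at 1 + σ is at most 1 + log y ≤ e² log y, and undoing the
  -- shift costs σ ∑ (log p)/p ≤ 2; hence 4 = 2 + 2.
  set σ := 1 / Real.log y with hσ
  have hσ0 : 0 < σ := by positivity
  have hexp : -(1 + σ) ≠ 0 := by linarith
  let a : ℕ →* ℝ :=
    { toFun := fun n => (n : ℝ) ^ (-(1 + σ))
      map_one' := by simp
      map_mul' := fun m n => by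
        rw [Nat.cast_mul, Real.mul_rpow (Nat.cast_nonneg m) (Nat.cast_nonneg n)] }
  have ha : ∀ n, a n = (n : ℝ) ^ (-(1 + σ)) := fun n => rfl
  have hsum : Summable a := by
    change Summable fun n : ℕ => (n : ℝ) ^ (-(1 + σ))
    rw [Real.summable_nat_rpow]
    linarith
  have hprod := EulerProduct.prod_filter_prime_geometric_eq_tsum_factoredNumbers hsum
    (Icc 1 ⌊y⌋₊)
  have hle : ∑' m : Nat.factoredNumbers (Icc 1 ⌊y⌋₊), a m ≤ 1 + Real.log y := by
    refine (Summable.tsum_subtype_le a (Nat.factoredNumbers (Icc 1 ⌊y⌋₊))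
      (fun n => by rw [ha]; positivity) hsum).trans ?_
    simpa [ha, hσ] using tsum_rpow_neg_one_sub_le hσ0
  have hlt : ∀ p ∈ (Icc 1 ⌊y⌋₊).filter Nat.Prime, a p < 1 := fun p hp => by
    rw [ha]
    exact Real.rpow_lt_one_of_one_lt_of_neg
      (by exact_mod_cast (mem_filter.mp hp).2.one_lt) (by linarith)
  have h1 : Real.exp (∑ p ∈ Icc 1 ⌊y⌋₊ with p.Prime, a p) ≤ 1 + Real.log y := by
    rw [← hprod] at hle
    refine le_trans ?_ hle
    rw [Real.exp_sum]
    refine prod_le_prod (fun _ _ => (Real.exp_pos _).le) fun p hp => ?_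
    have e : Real.exp (a p) = (Real.exp (-a p))⁻¹ := by rw [Real.exp_neg, inv_inv]
    rw [e]
    exact inv_anti₀ (by linarith [hlt p hp]) (by linarith [Real.add_one_le_exp (-a p)])
  have h2 : ∑ p ∈ Icc 1 ⌊y⌋₊ with p.Prime, a p ≤ Real.log (Real.log y) + 2 := by
    rw [← Real.le_log_iff_exp_le (by linarith)] at h1
    refine h1.trans ?_
    have h3 : 1 + Real.log y ≤ Real.log y * Real.exp 2 := by
      have := Real.add_one_le_exp (2 : ℝ)
      nlinarith
    calc _ ≤ Real.log (Real.log y * Real.exp 2) := Real.log_le_log (by linarith) h3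
      _ = _ := by rw [Real.log_mul hlog0.ne' (Real.exp_ne_zero _), Real.log_exp]
  have h4 : ∑ p ∈ Icc 1 ⌊y⌋₊ with p.Prime, (1 / (p : ℝ) - a p) ≤ 2 := by
    calc _ ≤ ∑ p ∈ Icc 1 ⌊y⌋₊ with p.Prime, σ * (Real.log p / (p : ℝ)) := by
          refine sum_le_sum fun p hp => ?_
          have hp0 : (0 : ℝ) < p := by exact_mod_cast (mem_filter.mp hp).2.pos
          have e : a p = 1 / (p : ℝ) * Real.exp (-(σ * Real.log p)) := by
            rw [ha, neg_add, Real.rpow_add hp0, Real.rpow_neg_one, Real.rpow_def_of_pos hp0]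
            congr 2 <;> ring
          rw [e]
          have := Real.add_one_le_exp (-(σ * Real.log p))
          have h0 : (0 : ℝ) < 1 / p := by positivity
          calc _ = 1 / (p : ℝ) * (1 - Real.exp (-(σ * Real.log p))) := by ring
            _ ≤ 1 / (p : ℝ) * (σ * Real.log p) := by gcongr; linarith
            _ = _ := by ring
      _ ≤ σ * (2 * Real.log y) := by
          rw [← mul_sum]
          gcongr
          exact sum_prime_log_div_le (by linarith)
      _ = 2 := by rw [hσ]; field_simp
  rw [sum_sub_distrib] at h4
  linarith

/-! ### The Euler product over friable integers -/

/-- Real part of -log(1 - z) = z + O(|z|²). -/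
theorem norm_one_sub_inv_le {z : ℂ} (hz : ‖z‖ ≤ 1 / 2) :
    ‖(1 - z)⁻¹‖ ≤ Real.exp (z.re + ‖z‖ ^ 2) := by
  have h := Complex.norm_log_one_add_sub_self_le (z := -z) (by rw [norm_neg]; linarith)
  rw [norm_neg] at h
  have hne : 1 + -z ≠ 0 := fun h0 => by
    have : z = 1 := by linear_combination -h0
    rw [this] at hz
    norm_num at hz
  have h1 : ‖z‖ ^ 2 * (1 - ‖z‖)⁻¹ / 2 ≤ ‖z‖ ^ 2 := by
    have : (1 - ‖z‖)⁻¹ ≤ 2 := by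
      rw [inv_le_comm₀ (by linarith) two_pos]; linarith
    nlinarith [sq_nonneg ‖z‖]
  have h2 := (Complex.abs_re_le_norm _).trans (h.trans h1)
  rw [abs_le] at h2
  have h3 : (1 - z)⁻¹ = Complex.exp (-Complex.log (1 + -z)) := by
    rw [Complex.exp_neg, Complex.exp_log hne, sub_eq_add_neg]
  rw [h3, Complex.norm_exp]
  simp only [Complex.sub_re, Complex.neg_re] at h2 ⊢
  gcongr
  linarith [h2.1]

theorem factoredNumbers_Icc_eq_friable {y : ℝ} (hy : 0 ≤ y) :
    Nat.factoredNumbers (Icc 1 ⌊y⌋₊) = friable y := by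
  ext m
  simp only [Nat.mem_factoredNumbers', friable, Set.mem_ofPred_eq, mem_Icc]
  constructor
  · intro h
    refine ⟨?_, fun p hp hpm => (Nat.le_floor_iff hy).mp (h p hp hpm).2⟩
    refine Nat.pos_of_ne_zero ?_
    rintro rfl
    -- Every prime divides 0, so a prime beyond y excludes it.
    obtain ⟨p, hp1, hp2⟩ := Nat.exists_infinite_primes (⌊y⌋₊ + 1)
    have := (h p hp2 (dvd_zero p)).2
    lia
  · rintro ⟨_, h⟩ p hp hpm
    exact ⟨hp.one_le, Nat.le_floor (h p hp hpm)⟩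

/-- The completely multiplicative function `n ↦ f(n) n^{-1 + 2πiv}`. -/
noncomputable def twistedTerm (f : ℕ → ℂ) (v : ℝ) (n : ℕ) : ℂ :=
  f n / (n : ℂ) * Complex.exp ((2 * Real.pi * (v * Real.log n) : ℝ) * Complex.I)

/-- The Euler product of `∑ f(n) n^{-1 + 2πiv}`, the sum being over `y`-friable integers. -/
noncomputable def friableEulerProduct (f : ℕ → ℂ) (y v : ℝ) : ℂ :=
  ∏ p ∈ Icc 1 ⌊y⌋₊ with p.Prime, (1 - twistedTerm f v p)⁻¹

theorem norm_twistedTerm (f : ℕ → ℂ) (v : ℝ) (n : ℕ) :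
    ‖twistedTerm f v n‖ = ‖f n / (n : ℂ)‖ := by
  rw [twistedTerm, norm_mul, Complex.norm_exp_ofReal_mul_I, mul_one]

theorem norm_twistedTerm_le {f : ℕ → ℂ} (hf : IsUnitBoundedCM f) (v : ℝ) {n : ℕ} (hn : 1 ≤ n) :
    ‖twistedTerm f v n‖ ≤ 1 / n := by
  rw [norm_twistedTerm, norm_div, Complex.norm_natCast]
  gcongr
  exact hf.norm_le_one n hn

theorem norm_twistedTerm_prime_le {f : ℕ → ℂ} (hf : IsUnitBoundedCM f) (v : ℝ) {p : ℕ}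
    (hp : p.Prime) : ‖twistedTerm f v p‖ ≤ 1 / 2 := by
  refine (norm_twistedTerm_le hf v hp.one_le).trans ?_
  have : (2 : ℝ) ≤ p := by exact_mod_cast hp.two_le
  gcongr

theorem contDiff_friableEulerProduct {f : ℕ → ℂ} (hf : IsUnitBoundedCM f) (y : ℝ)
    {n : WithTop ℕ∞} : ContDiff ℝ n (friableEulerProduct f y) := by
  refine contDiff_prod fun p hp => ?_
  refine ContDiff.inv ?_ fun v h0 => ?_
  · refine contDiff_const.sub (contDiff_const.mul (Complex.contDiff_exp.comp ?_))
    exact (Complex.ofRealCLM.contDiff.comp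
      (contDiff_const.mul (contDiff_id.mul contDiff_const))).mul contDiff_const
  · have h := norm_twistedTerm_prime_le hf v (mem_filter.mp hp).2
    rw [← sub_eq_zero.mp h0] at h
    norm_num at h

/-- The completely multiplicative function `n ↦ f(n) n^{-1 + 2πiv}`, zero at `0`, as a monoid
homomorphism. -/
noncomputable def twistedHom {f : ℕ → ℂ} (hf : IsUnitBoundedCM f) (v : ℝ) : ℕ →* ℂ where
  toFun := twistedTerm f v
  map_one' := by simp [twistedTerm, hf.map_one]
  map_mul' m n := by
    rcases Nat.eq_zero_or_pos m with rfl | hm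
    · simp [twistedTerm]
    rcases Nat.eq_zero_or_pos n with rfl | hn
    · simp [twistedTerm]
    have hm' : (m : ℝ) ≠ 0 := by exact_mod_cast hm.ne'
    have hn' : (n : ℝ) ≠ 0 := by exact_mod_cast hn.ne'
    simp only [twistedTerm]
    rw [hf.map_mul m n hm hn, Nat.cast_mul, Nat.cast_mul, Real.log_mul hm' hn', mul_add, mul_add,
      Complex.ofReal_add, add_mul, Complex.exp_add]
    ring

theorem hasSum_friableEulerProduct {f : ℕ → ℂ} (hf : IsUnitBoundedCM f) {y : ℝ}
    (hy : 0 ≤ y) (v : ℝ) :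
    HasSum ((friable y).indicator (twistedTerm f v)) (friableEulerProduct f y v) := by
  have hc : ∀ n, twistedHom hf v n = twistedTerm f v n := fun _ => rfl
  have h := (EulerProduct.summable_and_hasSum_factoredNumbers_prod_filter_prime_geometric
    (f := twistedHom hf v)
    (fun {p} hp => (hc p ▸ norm_twistedTerm_prime_le hf v hp).trans_lt (by norm_num))
    (Icc 1 ⌊y⌋₊)).2
  simp only [hc] at h
  rw [← factoredNumbers_Icc_eq_friable hy]
  exact hasSum_subtype_iff_indicator.mp h

/-- p^(2πiv) is the conjugate of p^(-2πiv), so frequency v corresponds to t = -2πv. -/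
theorem re_twistedTerm_eq (f : ℕ → ℂ) (v : ℝ) {p : ℕ} (hp : 1 ≤ p) :
    (twistedTerm f v p).re =
      (f p * (starRingEnd ℂ) (archChar (-(2 * Real.pi * v)) p)).re / (p : ℝ) := by
  have hp0 : (p : ℂ) ≠ 0 := by exact_mod_cast Nat.one_le_iff_ne_zero.mp hp
  have e : (starRingEnd ℂ) (archChar (-(2 * Real.pi * v)) p) =
      Complex.exp ((2 * Real.pi * (v * Real.log p) : ℝ) * Complex.I) := by
    rw [archChar, Complex.cpow_def_of_ne_zero hp0, ← Complex.exp_conj, ← Complex.natCast_log]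
    congr 1
    simp only [map_mul, Complex.conj_ofReal, Complex.conj_I]
    push_cast
    ring
  rw [e, twistedTerm, div_mul_eq_mul_div, ← Complex.ofReal_natCast, Complex.div_ofReal_re]

/-- The sum of the real parts of the prime terms is ∑ 1/p - 𝔻²; Mertens turns ∑ 1/p into log log y +
4, and the quadratic errors sum to at most K. -/
theorem exists_norm_friableEulerProduct_le :
    ∃ C : ℝ, 0 < C ∧ ∀ f : ℕ → ℂ, IsUnitBoundedCM f → ∀ y v : ℝ, 2 ≤ y →
      ‖friableEulerProduct f y v‖ ≤ C * (Real.log y *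
        Real.exp (-pretentiousDist f (archChar (-(2 * Real.pi * v))) y ^ 2)) := by
  have hsq : Summable fun n : ℕ => 1 / (n : ℝ) ^ 2 :=
    Real.summable_one_div_nat_pow.mpr one_lt_two
  set K := ∑' n : ℕ, 1 / (n : ℝ) ^ 2 with hK
  refine ⟨Real.exp (K + 4), Real.exp_pos _, fun f hf y v hy => ?_⟩
  have hlog : 0 < Real.log y := Real.log_pos (by linarith)
  rw [pretentiousDist_sq hf (isUnitBoundedCM_archChar _)]
  set s := (Icc 1 ⌊y⌋₊).filter Nat.Prime with hs
  have hprime : ∀ p ∈ s, p.Prime := fun p hp => (mem_filter.mp hp).2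
  have h1 : ‖friableEulerProduct f y v‖ ≤
      Real.exp (∑ p ∈ s, ((twistedTerm f v p).re + 1 / (p : ℝ) ^ 2)) := by
    rw [friableEulerProduct, norm_prod, Real.exp_sum]
    refine prod_le_prod (fun _ _ => norm_nonneg _) fun p hp => ?_
    refine (norm_one_sub_inv_le (norm_twistedTerm_prime_le hf v (hprime p hp))).trans ?_
    have := norm_twistedTerm_le hf v (hprime p hp).one_le
    gcongr
    calc _ ≤ (1 / (p : ℝ)) ^ 2 := by gcongr
      _ = _ := by rw [div_pow, one_pow]
  have h2 : ∑ p ∈ s, 1 / (p : ℝ) ^ 2 ≤ K := hsq.sum_le_tsum s fun n _ => by positivity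
  have h3 := sum_prime_inv_le hy
  have h4 : ∑ p ∈ s, (1 - (f p * (starRingEnd ℂ) (archChar (-(2 * Real.pi * v)) p)).re) / (p : ℝ)
      = ∑ p ∈ s, 1 / (p : ℝ) - ∑ p ∈ s, (twistedTerm f v p).re := by
    rw [← sum_sub_distrib]
    refine sum_congr rfl fun p hp => ?_
    rw [re_twistedTerm_eq f v (hprime p hp).one_le, sub_div]
  rw [sum_add_distrib] at h1
  rw [h4]
  calc _ ≤ _ := h1
    _ ≤ Real.exp ((K + 4) + (Real.log (Real.log y) +
          -(∑ p ∈ s, 1 / (p : ℝ) - ∑ p ∈ s, (twistedTerm f v p).re))) := by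
        refine Real.exp_le_exp.mpr ?_
        linarith
    _ = _ := by rw [Real.exp_add, Real.exp_add (Real.log _), Real.exp_log hlog]

/-! ### Conclusion -/

theorem theorem5p4 :
    ∃ C : ℝ, 0 < C ∧ ∀ f : ℕ → ℂ, IsUnitBoundedCM f →
      ∀ x y T : ℝ, 2 ≤ x → 2 ≤ y → 0 < T → T ≤ 1 →
        ‖∑ n ∈ Finset.Icc 1 ⌊x⌋₊ with n ∈ friable y, f n / (n : ℂ)‖ ≤
          C * (Real.log y * Real.exp (-minDistSq f y T) + 1 / T) := by
  obtain ⟨C₁, hC₁, h₁⟩ := exists_norm_logSum_le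
  obtain ⟨C₂, hC₂, h₂⟩ := exists_norm_friableEulerProduct_le
  refine ⟨C₁ * (C₂ + 1), by positivity, fun f hf x y T hx hy hT hT1 => ?_⟩
  have hlog : 0 < Real.log y := Real.log_pos (by linarith)
  have hy0 : 0 ≤ y := by linarith
  set E := Real.log y * Real.exp (-minDistSq f y T) with hE
  have hE0 : 0 ≤ E := by positivity
  -- As 0 is not friable, g 0 = 0, so g is bounded by 1 everywhere although f 0 is arbitrary.
  let g : ℕ → ℂ := (friable y).indicator f
  have hterm : ∀ v n, (friable y).indicator (twistedTerm f v) n = g n / (n : ℂ) *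
      Complex.exp ((2 * Real.pi * (v * Real.log n) : ℝ) * Complex.I) := by
    intro v n
    by_cases hn : n ∈ friable y <;> simp [g, hn, twistedTerm]
  have hnorm : ∀ n, ‖(friable y).indicator (twistedTerm f 0) n‖ = ‖g n / (n : ℂ)‖ := by
    intro n
    rw [hterm, norm_mul, Complex.norm_exp_ofReal_mul_I, mul_one]
  have hmem : ∀ m n : ℕ, 1 ≤ m → 1 ≤ n →
      (m * n ∈ friable y ↔ m ∈ friable y ∧ n ∈ friable y) := by
    intro m n hm hn
    constructor
    · rintro ⟨-, h⟩
      exact ⟨⟨hm, fun p hp hd => h p hp (hd.mul_right n)⟩,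
        ⟨hn, fun p hp hd => h p hp (hd.mul_left m)⟩⟩
    · rintro ⟨⟨-, h⟩, ⟨-, h'⟩⟩
      exact ⟨Nat.mul_pos hm hn, fun p hp hd => (hp.dvd_mul.mp hd).elim (h p hp) (h' p hp)⟩
  have hbound := h₁ g ?_ ?_ ?_ (friableEulerProduct f y) (contDiff_friableEulerProduct hf y) ?_
    (C₂ * E) T x (by positivity) hT hT1 hx ?_
  · have e : ∑ n ∈ Finset.Icc 1 ⌊x⌋₊ with n ∈ friable y, f n / (n : ℂ) = logSum g x := by
      rw [sum_filter, logSum]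
      refine sum_congr rfl fun n _ => ?_
      by_cases hn : n ∈ friable y <;> simp [g, hn]
    rw [e]
    refine hbound.trans ?_
    rw [mul_assoc]
    have : 0 < 1 / T := by positivity
    gcongr
    nlinarith
  · intro n
    by_cases hn : n ∈ friable y
    · simpa [g, hn] using hf.norm_le_one n hn.1
    · simp [g, hn]
  · intro m n hm hn
    by_cases h : m * n ∈ friable y
    · obtain ⟨hm', hn'⟩ := (hmem m n hm hn).mp h
      simp [g, h, hm', hn', hf.map_mul m n hm hn]
    · have h' := h
      rw [hmem m n hm hn, not_and_or] at h'
      rcases h' with h' | h' <;> simp [g, h, h']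
  · exact (hasSum_friableEulerProduct hf hy0 0).summable.norm.congr hnorm
  · intro v
    exact (hasSum_friableEulerProduct hf hy0 v).congr_fun fun n => (hterm v n).symm
  · intro v hv
    refine (h₂ f hf y v hy).trans ?_
    have hmin : minDistSq f y T ≤ pretentiousDist f (archChar (-(2 * Real.pi * v))) y ^ 2 :=
      (isLeast_minDistSq f y T hT.le).2 ⟨-(2 * Real.pi * v), by simpa using hv, rfl⟩
    rw [hE]
    gcongr
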